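/- **Setting (time).** Let $0=t_0<t_1<\cdots<t_N$, $\tau_k:=t_k-t_{k-1}$ $(1\le k\le N)$ and $r_k:=\tau_k/\tau_{k-1}$ $(2\le k\le N)$. Condition **S0**: $0<r_k\le r_{\mathrm{user}}$ for $2\le k\le N$, where $r_{\mathrm{user}}<4.864$. The BDF2 kernels are, for $n\ge2$, $$b_0^{(n)}:=\frac{1+2r_n}{\tau_n(1+r_n)},\qquad b_1^{(n)}:=-\frac{r_n^2}{\tau_n(1+r_n)},\qquad b_j^{(n)}:=0\ (j\ge2),$$ and the DOC kernels are $\theta_0^{(n)}:=1/b_0^{(n)}$ for $n\ge2$ and $\theta_{n-k}^{(n)}:=-\frac1{b_0^{(k)}}\sum_{j=k+1}^n\theta_{n-j}^{(n)}b_{j-k}^{(j)}$ for $n\ge k+1\ge3$. Write $\sum_{k,j}^{n,k}:=\sum_{k=2}^n\sum_{j=2}^k$. For $2\le n\le N$ let $B_2$ and $\Theta_2$ be the lower triangular $(n-1)\times(n-1)$ matrices with entries $b^{(k)}_{k-j}$ and $\theta^{(k)}_{k-j}$ $(2\le j\le k\le n)$, and put $\Lambda_\tau:=\mathrm{diag}(\sqrt{\tau_2},\dots,\sqrt{\tau_n})$,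 $\widetilde B_2:=\Lambda_\tau B_2\Lambda_\tau$, $\widetilde B:=\widetilde B_2+\widetilde B_2^T$, $\Theta:=\Theta_2+\Theta_2^T$. Let $\mathfrak m_1,\mathfrak m_2,\mathfrak m_3>0$ denote numbers with $$\lambda_{\min}(\widetilde B)\ge\mathfrak m_1,\qquad \lambda_{\max}(\widetilde B_2^T\widetilde B_2)\le\mathfrak m_2,\qquad v^T\Theta v\le\mathfrak m_3|\Lambda_\tau v|^2\ \text{ for all } v\in\mathbb R^{n-1}.\tag{1}$$ **Setting (space).** Let $L>0$, let $M$ be an even positive integer, $h=L/M$ and $\nu=2\pi/L$. Let $\mathbb V_h$ be the space of real $L$-periodic grid functions on the nodes $(ih,jh)$, $1\le i,j\le M$, with $\langle v,w\rangle:=h^2\sum v_hw_h$, $\|v\|:=\sqrt{\langle v,v\rangle}$, $\|v\|_{l^q}:=(h^2\sum|v_h|^q)^{1/q}$, and $\mathring{\mathbb V}_h:=\{v\in\mathbb V_h:\langle v,1\rangle=0\}$. Let $\widetilde v_{\ell,m}$ be the coefficients with $v_h=\sum_{\ell,m=-M/2}^{M/2-1}\widetilde v_{\ell,m}e^{\mathrm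 i\nu(\ell x+my)}$ at all nodes. The pseudo-spectral operators $\mathcal D_x,\mathcal D_y,\mathcal D_x^2,\mathcal D_y^2$ multiply $\widetilde v_{\ell,m}$ by $\mathrm i\nu\ell$, $\mathrm i\nu m$, $(\mathrm i\nu\ell)^2$, $(\mathrm i\nu m)^2$, respectively; $\Delta_h:=\mathcal D_x^2+\mathcal D_y^2$ and $\|\nabla_hv\|^2:=h^2\sum(|\mathcal D_xv_h|^2+|\mathcal D_yv_h|^2)$. Let $c_z>0$ denote a number with $$\|v\|_{l^6}\le c_z\|\nabla_hv\|\quad\text{for all } v\in\mathring{\mathbb V}_h.\tag{2}$$ **Lemma.** (a) There are $\mathfrak m_1,\mathfrak m_2,\mathfrak m_3>0$, depending only on $r_{\mathrm{user}}$, such that (1) holds for every $N$, every time mesh satisfying **S0** and every $2\le n\le N$. For each $L>0$ there is $c_z>0$, depending only on $L$, such that (2) holds for every even positive integer $M$. (b) Let **S0** hold, let $2\le n\le N$, and let $\mathfrak m_1,\mathfrak m_2,\mathfrak m_3>0$ and $c_z>0$ be any numbers satisfying (1) and (2). Let $u^k\in\mathbb V_h$ and $w^k\in\mathring{\mathbb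 V}_h$ $(2\le k\le n)$, and let $c_u$ be a constant with $\|u^k\|_{l^3}\le c_u$ for $2\le k\le n$. Then for every $\varepsilon>0$, $$\sum_{k,j}^{n,k}\theta_{k-j}^{(k)}\langle u^jw^j,\Delta_hw^k\rangle\le\varepsilon\sum_{k,j}^{n,k}\theta_{k-j}^{(k)}\langle\Delta_hw^j,\Delta_hw^k\rangle+\frac{c_z^4c_u^4\mathfrak m_2^3\mathfrak m_3^2}{\mathfrak m_1^5\varepsilon^3}\sum_{k=2}^n\tau_k\|w^k\|^2 .$$ -/

import Mathlib

noncomputable section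

namespace BDF2

open scoped Matrix ComplexConjugate

/-! ### Time meshes, the variable-step BDF2 kernels and the DOC kernels -/

/-- Nonuniform time levels `0 = t 0 < t 1 < ⋯ < t N`; values of `t` beyond `N` are irrelevant. -/
structure TimeMesh (N : ℕ) where
  t : ℕ → ℝ
  t_zero : t 0 = 0
  t_lt : ∀ k, 1 ≤ k → k ≤ N → t (k - 1) < t k

namespace TimeMesh

variable {N : ℕ} (T : TimeMesh N)

/-- The step size `τ_k = t_k - t_{k-1}` (`1 ≤ k ≤ N`). -/
def τ (k : ℕ) : ℝ := T.t k - T.t (k - 1)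

/-- The adjacent step ratio `r_k = τ_k / τ_{k-1}` (`2 ≤ k ≤ N`). -/
def r (k : ℕ) : ℝ := T.τ k / T.τ (k - 1)

/-- The step-ratio condition `0 < r_k ≤ r_user` for `2 ≤ k ≤ N`, where `r_user < 4.864`. -/
def S0 (rUser : ℝ) : Prop :=
  rUser < 4.864 ∧ ∀ k, 2 ≤ k → k ≤ N → 0 < T.r k ∧ T.r k ≤ rUser

/-- The BDF2 kernel: `T.b j n` is `b_j^{(n)}`, `n ≥ 2`. -/
def b (j n : ℕ) : ℝ :=
  match j with
  | 0 => (1 + 2 * T.r n) / (T.τ n * (1 + T.r n))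
  | 1 => -(T.r n ^ 2) / (T.τ n * (1 + T.r n))
  | _ + 2 => 0

/-- The discrete orthogonal convolution (DOC) kernel: `T.θ n d` is `θ_d^{(n)}`.
The recursion is the usual one, with `d = n - k` and the summation index `j = n - e`;
see `θ_zero` and `θ_sub` for the usual form. -/
def θ (n : ℕ) : ℕ → ℝ
  | 0 => 1 / T.b 0 n
  | d + 1 => -(1 / T.b 0 (n - (d + 1))) *
      ∑ e : Fin (d + 1), θ n e.1 * T.b (d + 1 - e.1) (n - e.1)
termination_by d => d
decreasing_by exact e.2

/-- `θ_0^{(n)} = 1 / b_0^{(n)}`. -/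
theorem θ_zero (n : ℕ) : T.θ n 0 = 1 / T.b 0 n := by
  rw [θ]

/-- `θ_{n-k}^{(n)} = -(1 / b_0^{(k)}) ∑_{j=k+1}^n θ_{n-j}^{(n)} b_{j-k}^{(j)}` for `n ≥ k + 1`. -/
theorem θ_sub (n k : ℕ) (hk : k + 1 ≤ n) :
    T.θ n (n - k) =
      -(1 / T.b 0 k) * ∑ j ∈ Finset.Icc (k + 1) n, T.θ n (n - j) * T.b (j - k) j := by
  obtain ⟨d, rfl⟩ : ∃ d, n = k + (d + 1) := ⟨n - (k + 1), by omega⟩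
  have h1 : k + (d + 1) - k = d + 1 := by omega
  have h2 : k + (d + 1) - (d + 1) = k := by omega
  rw [h1, θ, h2]
  congr 1
  rw [Fin.sum_univ_eq_sum_range
    (fun e => T.θ (k + (d + 1)) e * T.b (d + 1 - e) (k + (d + 1) - e)) (d + 1)]
  refine Finset.sum_nbij' (fun e => k + (d + 1) - e) (fun j => k + (d + 1) - j) ?_ ?_ ?_ ?_ ?_
  · intro e he; simp only [Finset.mem_range, Finset.mem_Icc] at *; omega
  · intro e he; simp only [Finset.mem_range, Finset.mem_Icc] at *; omega
  · intro e he; simp only [Finset.mem_range] at *; omega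
  · intro e he; simp only [Finset.mem_Icc] at *; omega
  · intro e he
    simp only [Finset.mem_range] at he
    have h3 : k + (d + 1) - (k + (d + 1) - e) = e := by omega
    have h4 : k + (d + 1) - e - k = d + 1 - e := by omega
    rw [h3, h4]

/-! The `(n-1) × (n-1)` matrices; the index `i : Fin (n - 1)` stands for the time level `i + 2`. -/

/-- The lower bidiagonal matrix `B₂` with entries `b_{k-j}^{(k)}`, `2 ≤ j ≤ k ≤ n`. -/
def B₂ (n : ℕ) : Matrix (Fin (n - 1)) (Fin (n - 1)) ℝ :=
  Matrix.of fun i j => if j ≤ i then T.b (i.1 - j.1) (i.1 + 2) else 0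

/-- `Λ_τ = diag(√τ_2, …, √τ_n)`. -/
def Λ (n : ℕ) : Matrix (Fin (n - 1)) (Fin (n - 1)) ℝ :=
  Matrix.diagonal fun i => √(T.τ (i.1 + 2))

/-- The step-scaled matrix `B̃₂ = Λ_τ B₂ Λ_τ`. -/
def Btilde₂ (n : ℕ) : Matrix (Fin (n - 1)) (Fin (n - 1)) ℝ := T.Λ n * T.B₂ n * T.Λ n

/-- The symmetric matrix `B̃ = B̃₂ + B̃₂ᵀ`. -/
def Btilde (n : ℕ) : Matrix (Fin (n - 1)) (Fin (n - 1)) ℝ := T.Btilde₂ n + (T.Btilde₂ n)ᵀ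

/-- The lower triangular matrix `Θ₂` with entries `θ_{k-j}^{(k)}`, `2 ≤ j ≤ k ≤ n`. -/
def Θ₂ (n : ℕ) : Matrix (Fin (n - 1)) (Fin (n - 1)) ℝ :=
  Matrix.of fun i j => if j ≤ i then T.θ (i.1 + 2) (i.1 - j.1) else 0

/-- The symmetric matrix `Θ = Θ₂ + Θ₂ᵀ`. -/
def Θ (n : ℕ) : Matrix (Fin (n - 1)) (Fin (n - 1)) ℝ := T.Θ₂ n + (T.Θ₂ n)ᵀ

/-- The positive numbers `m₁, m₂, m₃` satisfy `λ_min(B̃) ≥ m₁`, `λ_max(B̃₂ᵀ B̃₂) ≤ m₂` and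
`vᵀ Θ v ≤ m₃ |Λ_τ v|²` for all vectors `v`, at the time level `n`. -/
structure IsEigenBound (n : ℕ) (m₁ m₂ m₃ : ℝ) : Prop where
  pos₁ : 0 < m₁
  pos₂ : 0 < m₂
  pos₃ : 0 < m₃
  le_eigenvalue : ∀ μ ∈ spectrum ℝ (T.Btilde n), m₁ ≤ μ
  eigenvalue_le : ∀ μ ∈ spectrum ℝ ((T.Btilde₂ n)ᵀ * T.Btilde₂ n), μ ≤ m₂
  quadForm_le : ∀ v : Fin (n - 1) → ℝ,
    v ⬝ᵥ (T.Θ n *ᵥ v) ≤ m₃ * ((T.Λ n *ᵥ v) ⬝ᵥ (T.Λ n *ᵥ v))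

/-- `∑_{k,j}^{n,k} θ_{k-j}^{(k)} a(j,k) = ∑_{k=2}^n ∑_{j=2}^k θ_{k-j}^{(k)} a(j,k)`. -/
def docSum (n : ℕ) (a : ℕ → ℕ → ℝ) : ℝ :=
  ∑ k ∈ Finset.Icc 2 n, ∑ j ∈ Finset.Icc 2 k, T.θ k (k - j) * a j k

end TimeMesh

/-! ### Periodic grid functions and the Fourier pseudo-spectral operators -/

/-- Real `L`-periodic grid functions on the uniform `M × M` grid of `(0,L)²`: the node
`(ih, jh)`, `h = L/M`, has the indices `i, j` modulo `M`. -/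
abbrev GridFn (M : ℕ) : Type := ZMod M × ZMod M → ℝ

/-- The mesh length `h = L / M`. -/
def meshLen (L : ℝ) (M : ℕ) : ℝ := L / M

/-- The coordinate `ih` of a node (taken in `[0, L)`). -/
def coord (L : ℝ) {M : ℕ} (i : ZMod M) : ℝ := meshLen L M * (i.val : ℝ)

/-- `e_{ℓ,m}(x_h) = exp(iν(ℓx + my))` at a grid node, with `ν = 2π/L`. -/
def basisFn (L : ℝ) {M : ℕ} (ℓ m : ℤ) (p : ZMod M × ZMod M) : ℂ :=
  Complex.exp (Complex.I *
    ((2 * Real.pi / L * (ℓ * coord L p.1 + m * coord L p.2) : ℝ) : ℂ))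

/-- The frequencies `-M/2, …, M/2 - 1` (`M` even). -/
def freq (M : ℕ) : Finset ℤ := Finset.Ico (-((M : ℤ) / 2)) ((M : ℤ) / 2)

section

variable {M : ℕ} [NeZero M] (L : ℝ)

/-- The pseudo-spectral coefficient `ṽ_{ℓ,m}`, given by the discrete Fourier transform;
`sum_coeff_mul_basisFn` is the interpolation property which determines it. -/
def coeff (v : GridFn M) (ℓ m : ℤ) : ℂ :=
  (1 / (M : ℂ) ^ 2) * ∑ p, (v p : ℂ) * conj (basisFn L ℓ m p)

/-- `D_x v`. It can be complex-valued, by the unpaired frequency `-M/2`. -/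
def Dx (v : GridFn M) (p : ZMod M × ZMod M) : ℂ :=
  ∑ ℓ ∈ freq M, ∑ m ∈ freq M,
    (Complex.I * ((2 * Real.pi / L * ℓ : ℝ) : ℂ)) * coeff L v ℓ m * basisFn L ℓ m p

/-- `D_y v`. -/
def Dy (v : GridFn M) (p : ZMod M × ZMod M) : ℂ :=
  ∑ ℓ ∈ freq M, ∑ m ∈ freq M,
    (Complex.I * ((2 * Real.pi / L * m : ℝ) : ℂ)) * coeff L v ℓ m * basisFn L ℓ m p

/-- `D_x² v`. -/
def Dxx (v : GridFn M) (p : ZMod M × ZMod M) : ℂ :=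
  ∑ ℓ ∈ freq M, ∑ m ∈ freq M,
    (Complex.I * ((2 * Real.pi / L * ℓ : ℝ) : ℂ)) ^ 2 * coeff L v ℓ m * basisFn L ℓ m p

/-- `D_y² v`. -/
def Dyy (v : GridFn M) (p : ZMod M × ZMod M) : ℂ :=
  ∑ ℓ ∈ freq M, ∑ m ∈ freq M,
    (Complex.I * ((2 * Real.pi / L * m : ℝ) : ℂ)) ^ 2 * coeff L v ℓ m * basisFn L ℓ m p

/-- The discrete Laplacian `Δ_h v = (D_x² + D_y²) v`; its values are real, by `ofReal_lap`. -/
def lap (v : GridFn M) : GridFn M := fun p => (Dxx L v p + Dyy L v p).re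

/-- The discrete inner product `⟨v, w⟩ = h² ∑ v_h w_h`. -/
def gInner (v w : GridFn M) : ℝ := meshLen L M ^ 2 * ∑ p, v p * w p

/-- The discrete `l²` norm `‖v‖ = √⟨v, v⟩`. -/
def gNorm (v : GridFn M) : ℝ := √(gInner L v v)

/-- The discrete `l^q` norm. -/
def lqNorm (q : ℝ) (v : GridFn M) : ℝ :=
  (meshLen L M ^ 2 * ∑ p, |v p| ^ q) ^ (1 / q)

/-- The `H¹` seminorm `‖∇_h v‖`. -/
def gradNorm (v : GridFn M) : ℝ :=
  √(meshLen L M ^ 2 * ∑ p, (‖Dx L v p‖ ^ 2 + ‖Dy L v p‖ ^ 2))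

/-- Mean-zero grid functions: `⟨v, 1⟩ = 0`. -/
def MeanZero (v : GridFn M) : Prop := gInner L v 1 = 0

end

/-- `c_z` is a constant of the discrete embedding `‖v‖_{l⁶} ≤ c_z ‖∇_h v‖` for mean-zero grid
functions on the `M × M` grid of `(0,L)²`. -/
def IsEmbeddingConst (L : ℝ) (M : ℕ) [NeZero M] (c_z : ℝ) : Prop :=
  0 < c_z ∧ ∀ v : GridFn M, MeanZero L v → lqNorm L 6 v ≤ c_z * gradNorm L v

section

variable {M : ℕ} [NeZero M] {L : ℝ}

theorem basisFn_eq (hL : 0 < L) (ℓ m : ℤ) (p : ZMod M × ZMod M) :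
    basisFn L ℓ m p = ZMod.stdAddChar ((ℓ : ZMod M) * p.1 + (m : ZMod M) * p.2) := by
  have hM : (M : ℂ) ≠ 0 := Nat.cast_ne_zero.mpr (NeZero.ne M)
  have hL' : (L : ℂ) ≠ 0 := Complex.ofReal_ne_zero.mpr hL.ne'
  have h : (ℓ : ZMod M) * p.1 + (m : ZMod M) * p.2 =
      ((ℓ * (p.1.val : ℤ) + m * (p.2.val : ℤ) : ℤ) : ZMod M) := by
    push_cast
    simp
  rw [h, ZMod.stdAddChar_coe, basisFn, coord, coord, meshLen]
  congr 1
  push_cast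
  field_simp

theorem sum_freq (hM : Even M) (f : ZMod M → ℂ) :
    ∑ ℓ ∈ freq M, f (ℓ : ZMod M) = ∑ a, f a := by
  have hpos : 0 < M := Nat.pos_of_ne_zero (NeZero.ne M)
  obtain ⟨K, hK⟩ := hM
  refine Finset.sum_bij (fun ℓ _ => (ℓ : ZMod M)) (fun _ _ => Finset.mem_univ _) ?_ ?_
    (fun _ _ => rfl)
  · intro x hx y hy hxy
    rw [freq, Finset.mem_Ico] at hx hy
    have h := (ZMod.intCast_eq_intCast_iff_dvd_sub x y M).mp hxy
    have h2 := Int.eq_zero_of_abs_lt_dvd h (by rw [abs_lt]; constructor <;> omega)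
    omega
  · intro a _
    by_cases ha : a.valMinAbs = (M : ℤ) / 2
    · refine ⟨-((M : ℤ) / 2), ?_, ?_⟩
      · rw [freq, Finset.mem_Ico]; omega
      · have h1 : (-((M : ℤ) / 2)) = a.valMinAbs - (M : ℤ) := by omega
        rw [h1]; simp
    · refine ⟨a.valMinAbs, ?_, by simp⟩
      have h := ZMod.valMinAbs_mem_Ioc a
      rw [Set.mem_Ioc] at h
      rw [freq, Finset.mem_Ico]; omega

theorem sq_valMinAbs_freq (hM : Even M) {ℓ : ℤ} (h : ℓ ∈ freq M) :
    ((ℓ : ZMod M).valMinAbs) ^ 2 = ℓ ^ 2 := by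
  have hpos : 0 < M := Nat.pos_of_ne_zero (NeZero.ne M)
  obtain ⟨K, hK⟩ := hM
  rw [freq, Finset.mem_Ico] at h
  have h1 := ZMod.valMinAbs_mem_Ioc (ℓ : ZMod M)
  rw [Set.mem_Ioc] at h1
  have h2 : (((ℓ : ZMod M).valMinAbs : ℤ) : ZMod M) = (ℓ : ZMod M) := by simp
  have h3 := (ZMod.intCast_eq_intCast_iff_dvd_sub _ _ M).mp h2
  by_cases he : ℓ = -((M : ℤ) / 2)
  · by_cases hv : (ℓ : ZMod M).valMinAbs = (M : ℤ) / 2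
    · rw [hv, he]; ring
    · have := Int.eq_zero_of_abs_lt_dvd h3 (by rw [abs_lt]; constructor <;> omega)
      rw [show (ℓ : ZMod M).valMinAbs = ℓ by omega]
  · have := Int.eq_zero_of_abs_lt_dvd h3 (by rw [abs_lt]; constructor <;> omega)
    rw [show (ℓ : ZMod M).valMinAbs = ℓ by omega]

/-- The interpolation property `∑ ṽ_{ℓ,m} e_{ℓ,m}(x_h) = v_h`. -/
theorem sum_coeff_mul_basisFn (hL : 0 < L) (hM : Even M) (v : GridFn M)
    (p : ZMod M × ZMod M) :
    ∑ ℓ ∈ freq M, ∑ m ∈ freq M, coeff L v ℓ m * basisFn L ℓ m p = v p := by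
  have hM0 : (M : ℂ) ≠ 0 := Nat.cast_ne_zero.mpr (NeZero.ne M)
  let χ : AddChar (ZMod M) ℂ := ZMod.stdAddChar
  have key : ∀ ℓ m : ℤ, coeff L v ℓ m * basisFn L ℓ m p =
      ∑ q : ZMod M × ZMod M, (1 / (M : ℂ) ^ 2) * (v q : ℂ) *
        (χ ((ℓ : ZMod M) * (p.1 - q.1)) * χ ((m : ZMod M) * (p.2 - q.2))) := by
    intro ℓ m
    rw [coeff, Finset.mul_sum, Finset.sum_mul]
    refine Finset.sum_congr rfl fun q _ => ?_
    have h : χ ((ℓ : ZMod M) * (p.1 - q.1)) * χ ((m : ZMod M) * (p.2 - q.2)) =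
        conj (χ ((ℓ : ZMod M) * q.1 + (m : ZMod M) * q.2)) *
          χ ((ℓ : ZMod M) * p.1 + (m : ZMod M) * p.2) := by
      rw [← AddChar.map_neg_eq_conj, ← AddChar.map_add_eq_mul, ← AddChar.map_add_eq_mul]
      congr 1
      ring
    rw [h, basisFn_eq hL, basisFn_eq hL]
    simp only [χ]
    ring
  simp_rw [key]
  have h1 : ∀ ℓ : ℤ, ∑ m ∈ freq M, ∑ q : ZMod M × ZMod M, (1 / (M : ℂ) ^ 2) * (v q : ℂ) *
        (χ ((ℓ : ZMod M) * (p.1 - q.1)) * χ ((m : ZMod M) * (p.2 - q.2))) =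
      ∑ b : ZMod M, ∑ q : ZMod M × ZMod M, (1 / (M : ℂ) ^ 2) * (v q : ℂ) *
        (χ ((ℓ : ZMod M) * (p.1 - q.1)) * χ (b * (p.2 - q.2))) := fun ℓ =>
    sum_freq hM fun b => ∑ q : ZMod M × ZMod M, (1 / (M : ℂ) ^ 2) * (v q : ℂ) *
        (χ ((ℓ : ZMod M) * (p.1 - q.1)) * χ (b * (p.2 - q.2)))
  simp_rw [h1]
  rw [sum_freq hM fun a => ∑ b : ZMod M, ∑ q : ZMod M × ZMod M, (1 / (M : ℂ) ^ 2) * (v q : ℂ) *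
        (χ (a * (p.1 - q.1)) * χ (b * (p.2 - q.2)))]
  have h2 : ∀ c : ZMod M, ∑ a : ZMod M, χ (a * c) = if c = 0 then (M : ℂ) else 0 := by
    intro c
    have := AddChar.sum_mulShift c (ZMod.isPrimitive_stdAddChar M)
    simpa [ZMod.card] using this
  have h3 : ∑ a : ZMod M, ∑ b : ZMod M, ∑ q : ZMod M × ZMod M, (1 / (M : ℂ) ^ 2) * (v q : ℂ) *
        (χ (a * (p.1 - q.1)) * χ (b * (p.2 - q.2))) =
      ∑ q : ZMod M × ZMod M, (1 / (M : ℂ) ^ 2) * (v q : ℂ) *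
        ((∑ a : ZMod M, χ (a * (p.1 - q.1))) * ∑ b : ZMod M, χ (b * (p.2 - q.2))) := by
    simp_rw [Finset.sum_mul_sum, Finset.mul_sum]
    rw [Finset.sum_congr rfl fun a _ => Finset.sum_comm, Finset.sum_comm]
  rw [h3]
  simp_rw [h2]
  rw [Finset.sum_eq_single p]
  · simp only [sub_self, if_true]
    field_simp
  · intro q _ hq
    by_cases h : p.1 - q.1 = 0
    · have : p.2 - q.2 ≠ 0 := fun h' =>
        hq (Prod.ext (sub_eq_zero.mp h).symm (sub_eq_zero.mp h').symm)
      simp [this]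
    · simp [h]
  · simp

/-- The discrete Laplacian of a real grid function is real. -/
theorem ofReal_lap (hL : 0 < L) (hM : Even M) (v : GridFn M) (p : ZMod M × ZMod M) :
    ((lap L v p : ℝ) : ℂ) = Dxx L v p + Dyy L v p := by
  let χ : AddChar (ZMod M) ℂ := ZMod.stdAddChar
  let G : ZMod M → ZMod M → ℂ := fun a b =>
    (1 / (M : ℂ) ^ 2) * (∑ q : ZMod M × ZMod M, (v q : ℂ) * conj (χ (a * q.1 + b * q.2))) *
      χ (a * p.1 + b * p.2)
  have hG : ∀ ℓ m : ℤ, coeff L v ℓ m * basisFn L ℓ m p = G ℓ m := by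
    intro ℓ m
    simp only [coeff, basisFn_eq hL, G, χ]
  have hGc : ∀ a b, conj (G a b) = G (-a) (-b) := by
    intro a b
    simp only [G, map_mul, map_sum, Complex.conj_ofReal, map_div₀, map_one, map_pow,
      Complex.conj_natCast, ← AddChar.map_neg_eq_conj, neg_mul, neg_neg]
    simp only [← neg_add, neg_neg]
  let c : ℂ := ((-(2 * Real.pi / L) ^ 2 : ℝ) : ℂ)
  let H : ZMod M → ZMod M → ℂ := fun a b =>
    c * (((a.valMinAbs ^ 2 + b.valMinAbs ^ 2 : ℤ) : ℝ) : ℂ) * G a b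
  have hs : Dxx L v p + Dyy L v p = ∑ a, ∑ b, H a b := by
    rw [← sum_freq hM fun a => ∑ b, H a b, Dxx, Dyy, ← Finset.sum_add_distrib]
    refine Finset.sum_congr rfl fun ℓ hℓ => ?_
    rw [← sum_freq hM fun b => H ℓ b, ← Finset.sum_add_distrib]
    refine Finset.sum_congr rfl fun m hm => ?_
    simp only [H, c, sq_valMinAbs_freq hM hℓ, sq_valMinAbs_freq hM hm, ← hG]
    push_cast
    simp only [mul_pow, Complex.I_sq]
    ring
  have hr : conj (Dxx L v p + Dyy L v p) = Dxx L v p + Dyy L v p := by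
    have hn : ∀ a : ZMod M, (-a).valMinAbs ^ 2 = a.valMinAbs ^ 2 := fun a => by
      rw [← Int.natAbs_sq (-a).valMinAbs, ZMod.natAbs_valMinAbs_neg, Int.natAbs_sq]
    have hH : ∀ a b, conj (H a b) = H (-a) (-b) := by
      intro a b
      simp only [H, c, map_mul, Complex.conj_ofReal, hGc, hn]
    rw [hs]
    simp only [map_sum, hH]
    rw [← Equiv.sum_comp (Equiv.neg (ZMod M)) fun a => ∑ b, H a b]
    refine Finset.sum_congr rfl fun a _ => ?_
    exact Equiv.sum_comp (Equiv.neg (ZMod M)) fun b => H (-a) b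
  rw [lap]
  exact Complex.conj_eq_iff_re.mp hr

end

end BDF2

end

open BDF2

noncomputable section

namespace BDF2

open scoped Matrix ComplexConjugate

/-! ### Rayleigh quotients of real symmetric matrices -/

section Rayleigh

variable {ι : Type*} [Fintype ι]

/-! Time constants: `Btilde₂` is bidiagonal, with diagonal (1+2r)/(1+r) and subdiagonal
-r^{3/2}/(1+r). After e·xy ≤ e(x²+y²)/2, its quadratic form stays coercive as long as r^{3/2} <
1+2r, that is, r below about 4.8645; the cap 4.864 leaves a small uniform gap (`S0.le_quadForm`).
Since `Θ₂` inverts `B₂`, the bound on `Θ` follows by duality.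

Embedding constant: since |e^{ix} - 1| ≤ |x|, Parseval bounds forward differences by the spectral
derivatives. A discrete Gagliardo inequality applied to v² and then to |v|³ climbs from l² to l⁴ to
l⁶, and Poincaré's inequality closes the chain (`sum_sq_le_of_variation`, `sum_pow_six_le`).

Convolution inequality: at each node let z be the time history of Δ_h w and y = B̃₂⁻ᵀΛz, so that
zᵀΘ₂f = y·Λf (`exists_dual_vector_bounds`). Let Y be the total of |y|², Q the dissipation sum, S the
left side and W the weighted sum of ‖w‖². Then Y ≤ 2Q/m₁, Σ τ‖Δ_h w‖² ≤ m₂Y and S² ≤ Y Σ τ‖uw‖².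
Hölder, the embedding and ‖∇_h w‖² ≤ ‖Δ_h w‖‖w‖ turn this into S⁴ ≤ (c_u c_z)⁴ m₂ W Y³. A sharp
Young inequality splits the result, and m₁ ≤ m₂m₃ (`IsEigenBound.le_mul`) brings the constant to its
stated form. -/

/-- Subtracting m times the identity translates the spectrum by m, so both sides express positive
semidefiniteness of the shifted matrix. -/
theorem forall_spectrum_ge_iff [DecidableEq ι] {S : Matrix ι ι ℝ} (hS : S.IsHermitian) (m : ℝ) :
    (∀ μ ∈ spectrum ℝ S, m ≤ μ) ↔ ∀ v : ι → ℝ, m * (v ⬝ᵥ v) ≤ v ⬝ᵥ (S *ᵥ v) := by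
  have hH : (S - algebraMap ℝ (Matrix ι ι ℝ) m).IsHermitian := by
    refine hS.sub ?_
    rw [Matrix.IsHermitian, Matrix.algebraMap_eq_diagonal, Matrix.diagonal_conjTranspose]
    rfl
  have h := Matrix.posSemidef_iff_isHermitian_and_spectrum_nonneg
    (A := S - algebraMap ℝ (Matrix ι ι ℝ) m)
  have h' := Matrix.posSemidef_iff_dotProduct_mulVec
    (M := S - algebraMap ℝ (Matrix ι ι ℝ) m)
  have e1 : (∀ μ ∈ spectrum ℝ S, m ≤ μ) ↔
      spectrum ℝ (S - algebraMap ℝ (Matrix ι ι ℝ) m) ⊆ {a : ℝ | 0 ≤ a} := by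
    have key : ∀ μ, μ ∈ spectrum ℝ (S - algebraMap ℝ (Matrix ι ι ℝ) m) ↔
        μ + m ∈ spectrum ℝ S := by
      intro μ
      rw [spectrum.mem_iff, spectrum.mem_iff, map_add]
      rw [show algebraMap ℝ (Matrix ι ι ℝ) μ - (S - algebraMap ℝ (Matrix ι ι ℝ) m) =
        algebraMap ℝ (Matrix ι ι ℝ) μ + algebraMap ℝ (Matrix ι ι ℝ) m - S by abel]
    constructor
    · intro hm μ hμ
      have := hm _ ((key μ).mp hμ)
      simp only [Set.mem_ofPred_eq]; linarith
    · intro hm μ hμ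
      have := hm ((key (μ - m)).mpr (by simpa using hμ))
      simp only [Set.mem_ofPred_eq] at this; linarith
  have e2 : (∀ v : ι → ℝ, m * (v ⬝ᵥ v) ≤ v ⬝ᵥ (S *ᵥ v)) ↔
      ∀ v : ι → ℝ, 0 ≤ star v ⬝ᵥ ((S - algebraMap ℝ (Matrix ι ι ℝ) m) *ᵥ v) := by
    refine forall_congr' fun v => ?_
    rw [Matrix.sub_mulVec, dotProduct_sub, Algebra.algebraMap_eq_smul_one, Matrix.smul_mulVec,
      Matrix.one_mulVec, dotProduct_smul, smul_eq_mul, star_trivial, sub_nonneg]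
  rw [e1, e2]
  constructor
  · exact fun hs => (h'.mp (h.mpr ⟨hH, hs⟩)).2
  · exact fun hs => (h.mp (h'.mpr ⟨hH, hs⟩)).2

theorem forall_spectrum_le_iff [DecidableEq ι] {S : Matrix ι ι ℝ} (hS : S.IsHermitian) (m : ℝ) :
    (∀ μ ∈ spectrum ℝ S, μ ≤ m) ↔ ∀ v : ι → ℝ, v ⬝ᵥ (S *ᵥ v) ≤ m * (v ⬝ᵥ v) := by
  have h := forall_spectrum_ge_iff hS.neg (-m)
  have e1 : (∀ μ ∈ spectrum ℝ S, μ ≤ m) ↔ ∀ μ ∈ spectrum ℝ (-S), -m ≤ μ := by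
    rw [← spectrum.neg_eq]
    constructor
    · intro H μ hμ
      have := H (-μ) (Set.mem_neg.mp hμ)
      linarith
    · intro H μ hμ
      have := H (-μ) (by simpa using hμ)
      linarith
  rw [e1, h]
  refine forall_congr' fun v => ?_
  rw [Matrix.neg_mulVec, dotProduct_neg, neg_mul, neg_le_neg_iff]

theorem dotProduct_add_transpose_mulVec (A : Matrix ι ι ℝ) (v : ι → ℝ) :
    v ⬝ᵥ ((A + Aᵀ) *ᵥ v) = 2 * (v ⬝ᵥ (A *ᵥ v)) := by
  rw [Matrix.add_mulVec, dotProduct_add, Matrix.mulVec_transpose, dotProduct_comm v (v ᵥ* A),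
    ← Matrix.dotProduct_mulVec]
  ring

theorem dotProduct_transpose_mul_self_mulVec (A : Matrix ι ι ℝ) (v : ι → ℝ) :
    v ⬝ᵥ ((Aᵀ * A) *ᵥ v) = (A *ᵥ v) ⬝ᵥ (A *ᵥ v) := by
  rw [← Matrix.mulVec_mulVec, Matrix.dotProduct_mulVec, Matrix.vecMul_transpose]

theorem isHermitian_add_transpose {ι : Type*} (A : Matrix ι ι ℝ) : (A + Aᵀ).IsHermitian := by
  rw [Matrix.IsHermitian, Matrix.conjTranspose_eq_transpose_of_trivial, Matrix.transpose_add,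
    Matrix.transpose_transpose, add_comm]

theorem isHermitian_transpose_mul_self_real (A : Matrix ι ι ℝ) : (Aᵀ * A).IsHermitian := by
  rw [Matrix.IsHermitian, Matrix.conjTranspose_eq_transpose_of_trivial, Matrix.transpose_mul,
    Matrix.transpose_transpose]

theorem sq_dotProduct_le (v w : ι → ℝ) : (v ⬝ᵥ w) ^ 2 ≤ (v ⬝ᵥ v) * (w ⬝ᵥ w) := by
  have := Finset.sum_mul_sq_le_sq_mul_sq Finset.univ v w
  simpa only [dotProduct, sq] using this

theorem dotProduct_self_nonneg_real (v : ι → ℝ) : 0 ≤ v ⬝ᵥ v :=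
  Finset.sum_nonneg fun i _ => mul_self_nonneg (v i)

/-- A bound for `A` is one for `Aᵀ`. -/
theorem transpose_mulVec_bound {A : Matrix ι ι ℝ} {m : ℝ}
    (h : ∀ v : ι → ℝ, (A *ᵥ v) ⬝ᵥ (A *ᵥ v) ≤ m * (v ⬝ᵥ v)) (y : ι → ℝ) :
    (Aᵀ *ᵥ y) ⬝ᵥ (Aᵀ *ᵥ y) ≤ m * (y ⬝ᵥ y) := by
  set x := Aᵀ *ᵥ y with hx
  have h1 : x ⬝ᵥ x = y ⬝ᵥ (A *ᵥ x) := by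
    rw [Matrix.dotProduct_mulVec y, ← Matrix.mulVec_transpose]
  have h2 := sq_dotProduct_le y (A *ᵥ x)
  have h3 := h x
  have h4 := dotProduct_self_nonneg_real y
  have h5 := dotProduct_self_nonneg_real x
  rw [← h1] at h2
  -- Cauchy–Schwarz gives |x|⁴ ≤ |y|² m |x|², to be divided by |x|². No sign of m is assumed, so if
  -- x = 0 the claim 0 ≤ m|y|² comes from the hypothesis at y.
  rcases h5.eq_or_lt with h6 | h6
  · have : 0 ≤ m * (x ⬝ᵥ x) := (dotProduct_self_nonneg_real (A *ᵥ x)).trans h3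
    rw [← h6]
    by_contra hc
    push Not at hc
    have hy : 0 < y ⬝ᵥ y := by
      rcases h4.eq_or_lt with h7 | h7
      · rw [← h7] at hc; simp at hc
      · exact h7
    have := (dotProduct_self_nonneg_real (A *ᵥ y)).trans (h y)
    linarith
  · have h7 : (x ⬝ᵥ x) ^ 2 ≤ (y ⬝ᵥ y) * (m * (x ⬝ᵥ x)) :=
      h2.trans (mul_le_mul_of_nonneg_left h3 h4)
    have h8 : (x ⬝ᵥ x) * (x ⬝ᵥ x) ≤ (m * (y ⬝ᵥ y)) * (x ⬝ᵥ x) := by nlinarith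
    exact le_of_mul_le_mul_right h8 h6

end Rayleigh

/-- Sums over the matrix indices are sums over the time levels `2, …, n`. -/
theorem sum_fin_eq_sum_Icc {α : Type*} [AddCommMonoid α] (n : ℕ) (f : ℕ → α) :
    ∑ i : Fin (n - 1), f (i.1 + 2) = ∑ k ∈ Finset.Icc 2 n, f k := by
  rw [Fin.sum_univ_eq_sum_range (fun i => f (i + 2)) (n - 1)]
  refine Finset.sum_nbij' (fun i => i + 2) (fun k => k - 2) ?_ ?_ ?_ ?_ ?_
  · intro i hi; simp only [Finset.mem_range, Finset.mem_Icc] at *; omega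
  · intro i hi; simp only [Finset.mem_range, Finset.mem_Icc] at *; omega
  · intro i hi; simp
  · intro i hi; simp only [Finset.mem_Icc] at *; omega
  · intro i hi; rfl

/-! ### The DOC matrix as the inverse of the BDF2 matrix. -/

namespace TimeMesh

variable {N : ℕ} {T : TimeMesh N} {rUser : ℝ}

theorem τ_pos {k : ℕ} (h1 : 1 ≤ k) (h2 : k ≤ N) : 0 < T.τ k :=
  sub_pos.mpr (T.t_lt k h1 h2)

theorem r_pos {k : ℕ} (h1 : 2 ≤ k) (h2 : k ≤ N) : 0 < T.r k :=
  div_pos (τ_pos (by omega) h2) (τ_pos (by omega) (by omega))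

theorem b_zero_pos {k : ℕ} (h1 : 2 ≤ k) (h2 : k ≤ N) : 0 < T.b 0 k := by
  have := T.r_pos h1 h2
  have := T.τ_pos (by omega : 1 ≤ k) h2
  simp only [b]; positivity

/-- The discrete orthogonality of the DOC kernels. -/
theorem sum_θ_mul_b {k n : ℕ} (h1 : 2 ≤ k) (hkn : k ≤ n) (h2 : n ≤ N) :
    ∑ j ∈ Finset.Icc k n, T.θ n (n - j) * T.b (j - k) j = if k = n then 1 else 0 := by
  have hb := (T.b_zero_pos h1 (hkn.trans h2)).ne'
  rw [← Finset.add_sum_Ioc_eq_sum_Icc hkn]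
  split_ifs with h
  · subst h
    simp [T.θ_zero, hb]
  · have hI : Finset.Ioc k n = Finset.Icc (k + 1) n := by
      ext; simp only [Finset.mem_Ioc, Finset.mem_Icc]; omega
    rw [hI, T.θ_sub n k (by omega), Nat.sub_self]
    field_simp
    ring

theorem Θ₂_mul_B₂ {n : ℕ} (hn : n ≤ N) : T.Θ₂ n * T.B₂ n = 1 := by
  ext i j
  rw [Matrix.mul_apply, Matrix.one_apply]
  -- Triangularity of both factors cuts the product sum down to the levels between column and row,
  -- where it is the orthogonality sum.
  let F : ℕ → ℝ := fun k => if k ∈ Finset.Icc (j.1 + 2) (i.1 + 2) then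
    T.θ (i.1 + 2) (i.1 + 2 - k) * T.b (k - (j.1 + 2)) k else 0
  have h : ∀ l : Fin (n - 1), T.Θ₂ n i l * T.B₂ n l j = F (l.1 + 2) := by
    intro l
    simp only [F, Θ₂, B₂, Matrix.of_apply, Finset.mem_Icc, Fin.le_def, Nat.add_sub_add_right,
      add_le_add_iff_right]
    split_ifs <;> first | rfl | (exfalso; omega) | simp
  refine ((Finset.sum_congr rfl fun l _ => h l).trans (sum_fin_eq_sum_Icc n F)).trans ?_
  simp only [F]
  rw [Finset.sum_ite_mem]
  have hi := i.2
  have hI : Finset.Icc 2 n ∩ Finset.Icc (j.1 + 2) (i.1 + 2) =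
      Finset.Icc (j.1 + 2) (i.1 + 2) := by
    ext; simp only [Finset.mem_Icc, Finset.mem_inter]; omega
  rw [hI]
  rcases le_or_gt j i with hji | hji
  · rw [sum_θ_mul_b (by omega) (by simpa using hji) (by omega)]
    simp only [Fin.ext_iff]
    split_ifs <;> first | rfl | (exfalso; omega)
  · rw [Finset.Icc_eq_empty (by rw [Fin.lt_def] at hji; omega), Finset.sum_empty, if_neg hji.ne]

theorem B₂_mul_Θ₂ {n : ℕ} (hn : n ≤ N) : T.B₂ n * T.Θ₂ n = 1 :=
  mul_eq_one_comm.mp (T.Θ₂_mul_B₂ hn)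

/-- The inverse of `Λ_τ`. -/
def Λinv (T : TimeMesh N) (n : ℕ) : Matrix (Fin (n - 1)) (Fin (n - 1)) ℝ :=
  Matrix.diagonal fun i => (√(T.τ (i.1 + 2)))⁻¹

theorem Λ_mul_Λinv {n : ℕ} (hn : n ≤ N) : T.Λ n * T.Λinv n = 1 := by
  rw [Λ, Λinv, Matrix.diagonal_mul_diagonal, ← Matrix.diagonal_one]
  congr 1
  ext i
  have := i.2
  exact mul_inv_cancel₀ (Real.sqrt_pos.mpr (T.τ_pos (by omega) (by omega))).ne'

theorem Λinv_mul_Λ {n : ℕ} (hn : n ≤ N) : T.Λinv n * T.Λ n = 1 :=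
  mul_eq_one_comm.mp (T.Λ_mul_Λinv hn)

theorem Λ_transpose (n : ℕ) : (T.Λ n)ᵀ = T.Λ n := Matrix.diagonal_transpose _

/-- `B̃₂⁻¹ = Λ⁻¹ Θ₂ Λ⁻¹`. -/
theorem Btilde₂_mul_inv {n : ℕ} (hn : n ≤ N) :
    T.Btilde₂ n * (T.Λinv n * T.Θ₂ n * T.Λinv n) = 1 := by
  calc T.Btilde₂ n * (T.Λinv n * T.Θ₂ n * T.Λinv n)
      = T.Λ n * (T.B₂ n * ((T.Λ n * T.Λinv n) * T.Θ₂ n)) * T.Λinv n := by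
        simp only [Btilde₂, Matrix.mul_assoc]
    _ = 1 := by
        rw [Λ_mul_Λinv hn, Matrix.one_mul, B₂_mul_Θ₂ hn, Matrix.mul_one, Λ_mul_Λinv hn]

/-! ### Quadratic forms of the DOC kernels -/

/-- With `y = B̃₂⁻ᵀ Λ z`, the bilinear form of `Θ₂` is `⟨y, Λ f⟩`. -/
theorem exists_dual_vector {n : ℕ} (hn : n ≤ N) (z : Fin (n - 1) → ℝ) :
    ∃ y : Fin (n - 1) → ℝ, (T.Btilde₂ n)ᵀ *ᵥ y = T.Λ n *ᵥ z ∧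
      ∀ f : Fin (n - 1) → ℝ, z ⬝ᵥ (T.Θ₂ n *ᵥ f) = y ⬝ᵥ (T.Λ n *ᵥ f) := by
  have h1 : T.Θ₂ n = T.Λ n * (T.Λinv n * T.Θ₂ n * T.Λinv n) * T.Λ n := by
    calc T.Θ₂ n = (T.Λ n * T.Λinv n) * T.Θ₂ n * (T.Λinv n * T.Λ n) := by
          rw [Λ_mul_Λinv hn, Λinv_mul_Λ hn, Matrix.one_mul, Matrix.mul_one]
      _ = _ := by simp only [Matrix.mul_assoc]
  set C := T.Λinv n * T.Θ₂ n * T.Λinv n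
  have hC : C * T.Btilde₂ n = 1 := mul_eq_one_comm.mp (T.Btilde₂_mul_inv hn)
  refine ⟨Cᵀ *ᵥ (T.Λ n *ᵥ z), ?_, fun f => ?_⟩
  · rw [Matrix.mulVec_mulVec, ← Matrix.transpose_mul, hC, Matrix.transpose_one, Matrix.one_mulVec]
  · rw [h1, ← Matrix.mulVec_mulVec, ← Matrix.mulVec_mulVec, Matrix.dotProduct_mulVec z,
      Matrix.dotProduct_mulVec (z ᵥ* T.Λ n), ← Matrix.mulVec_transpose, ← Matrix.mulVec_transpose,
      Λ_transpose]

namespace IsEigenBound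

variable {n : ℕ} {m₁ m₂ m₃ : ℝ}

theorem le_quadForm (h : T.IsEigenBound n m₁ m₂ m₃) (v : Fin (n - 1) → ℝ) :
    m₁ / 2 * (v ⬝ᵥ v) ≤ v ⬝ᵥ (T.Btilde₂ n *ᵥ v) := by
  have := (forall_spectrum_ge_iff (isHermitian_add_transpose (T.Btilde₂ n)) m₁).mp
    h.le_eigenvalue v
  rw [dotProduct_add_transpose_mulVec] at this
  linarith

theorem norm_mulVec_le (h : T.IsEigenBound n m₁ m₂ m₃) (v : Fin (n - 1) → ℝ) :
    (T.Btilde₂ n *ᵥ v) ⬝ᵥ (T.Btilde₂ n *ᵥ v) ≤ m₂ * (v ⬝ᵥ v) := by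
  have := (forall_spectrum_le_iff (isHermitian_transpose_mul_self_real (T.Btilde₂ n)) m₂).mp
    h.eigenvalue_le v
  rwa [dotProduct_transpose_mul_self_mulVec] at this

/-- Because B̃₂ᵀy = Λz, the form zᵀΘ₂z equals y·B̃₂y, which is coercive, and |Λz| = |B̃₂ᵀy| is
controlled by the norm bound carried over to the transpose. -/
theorem exists_dual_vector_bounds (h : T.IsEigenBound n m₁ m₂ m₃) (hn : n ≤ N)
    (z : Fin (n - 1) → ℝ) :
    ∃ y : Fin (n - 1) → ℝ, m₁ / 2 * (y ⬝ᵥ y) ≤ z ⬝ᵥ (T.Θ₂ n *ᵥ z) ∧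
      (T.Λ n *ᵥ z) ⬝ᵥ (T.Λ n *ᵥ z) ≤ m₂ * (y ⬝ᵥ y) ∧
      ∀ f : Fin (n - 1) → ℝ, z ⬝ᵥ (T.Θ₂ n *ᵥ f) = y ⬝ᵥ (T.Λ n *ᵥ f) := by
  obtain ⟨y, hy, hf⟩ := T.exists_dual_vector hn z
  refine ⟨y, ?_, ?_, hf⟩
  · rw [hf z, ← hy, Matrix.mulVec_transpose, dotProduct_comm y (_ ᵥ* _),
      ← Matrix.dotProduct_mulVec]
    exact h.le_quadForm y
  · rw [← hy]
    exact transpose_mulVec_bound h.norm_mulVec_le y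

/-- Any z with Λz ≠ 0 serves as a test vector: m₁|Λz|² ≤ m₂m₁|y|² ≤ m₂m₃|Λz|². The condition 2 ≤ n
makes the index set nonempty. -/
theorem le_mul (h : T.IsEigenBound n m₁ m₂ m₃) (h2 : 2 ≤ n) (hn : n ≤ N) : m₁ ≤ m₂ * m₃ := by
  let z : Fin (n - 1) → ℝ := fun _ => 1
  obtain ⟨y, h3, h4, -⟩ := h.exists_dual_vector_bounds hn z
  have h5 := h.quadForm_le z
  rw [Θ, dotProduct_add_transpose_mulVec] at h5
  have h6 : 0 < (T.Λ n *ᵥ z) ⬝ᵥ (T.Λ n *ᵥ z) := by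
    refine Finset.sum_pos (fun i _ => ?_) ⟨⟨0, by omega⟩, Finset.mem_univ _⟩
    rw [Λ, Matrix.mulVec_diagonal]
    have := i.2
    have := Real.sqrt_pos.mpr (T.τ_pos (k := i.1 + 2) (by omega) (by omega))
    positivity
  set a := (T.Λ n *ᵥ z) ⬝ᵥ (T.Λ n *ᵥ z)
  have h7 : m₁ * a ≤ m₂ * m₃ * a := by
    calc m₁ * a ≤ m₁ * (m₂ * (y ⬝ᵥ y)) := mul_le_mul_of_nonneg_left h4 h.pos₁.le
      _ = m₂ * (m₁ * (y ⬝ᵥ y)) := by ring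
      _ ≤ m₂ * (m₃ * a) := mul_le_mul_of_nonneg_left (by linarith) h.pos₂.le
      _ = _ := by ring
  exact le_of_mul_le_mul_right h7 h6

end IsEigenBound

/-! ### The eigenvalue bounds under the step-ratio condition -/

/-- Extension of a vector by zero to all time levels. -/
def extend (n : ℕ) (v : Fin (n - 1) → ℝ) (k : ℕ) : ℝ :=
  if h : 2 ≤ k ∧ k ≤ n then v ⟨k - 2, by omega⟩ else 0

theorem extend_fin {n : ℕ} (v : Fin (n - 1) → ℝ) (i : Fin (n - 1)) :
    extend n v (i.1 + 2) = v i := by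
  have := i.2
  rw [extend, dif_pos (by omega)]
  rfl

/-- The ratio `r_k^{3/2} / (1 + r_k)`, the modulus of the subdiagonal of `B̃₂`. -/
def subdiag (T : TimeMesh N) (k : ℕ) : ℝ := √(T.r k) ^ 3 / (1 + T.r k)

/-- The scaling by √τ on both sides removes the step sizes: τ_k b_0 and √(τ_k τ_{k-1}) b_1 depend on
r_k alone. -/
theorem Btilde₂_mulVec {n : ℕ} (hn : n ≤ N) (v : Fin (n - 1) → ℝ) (i : Fin (n - 1)) :
    (T.Btilde₂ n *ᵥ v) i =
      (1 + 2 * T.r (i.1 + 2)) / (1 + T.r (i.1 + 2)) * extend n v (i.1 + 2) -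
        T.subdiag (i.1 + 2) * extend n v (i.1 + 1) := by
  have hi := i.2
  have hτ := T.τ_pos (k := i.1 + 2) (by omega) (by omega)
  have hτ' := T.τ_pos (k := i.1 + 1) (by omega) (by omega)
  have hr := T.r_pos (k := i.1 + 2) (by omega) (by omega)
  let F : ℕ → ℝ := fun k =>
    (if k = i.1 + 2 then T.τ (i.1 + 2) * T.b 0 (i.1 + 2) * extend n v (i.1 + 2) else 0) +
    (if k = i.1 + 1 then √(T.τ (i.1 + 2)) * √(T.τ (i.1 + 1)) * T.b 1 (i.1 + 2) *
      extend n v (i.1 + 1) else 0)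
  have h : ∀ j : Fin (n - 1), T.Btilde₂ n i j * v j = F (j.1 + 2) := by
    intro j
    simp only [F, Btilde₂, Λ, B₂, Matrix.mul_diagonal, Matrix.diagonal_mul, Matrix.of_apply,
      Fin.le_def]
    by_cases h1 : j.1 = i.1
    · have : j = i := Fin.ext h1
      subst this
      simp only [le_refl, if_true, Nat.sub_self, extend_fin]
      rw [if_neg (by omega)]
      have := Real.mul_self_sqrt hτ.le
      linear_combination (T.b 0 (j.1 + 2) * v j) * this
    · by_cases h2 : j.1 + 1 = i.1
      · have h3 : i.1 - j.1 = 1 := by omega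
        rw [if_pos (show j.1 ≤ i.1 by omega), if_neg (show ¬(j.1 + 2 = i.1 + 2) by omega),
          if_pos (show j.1 + 2 = i.1 + 1 by omega), h3, ← h2, show j.1 + 1 + 1 = j.1 + 2 by omega, extend_fin]
        ring
      · rw [if_neg (show ¬(j.1 + 2 = i.1 + 2) by omega),
          if_neg (show ¬(j.1 + 2 = i.1 + 1) by omega)]
        split_ifs with h3
        · obtain ⟨d, hd⟩ : ∃ d, i.1 - j.1 = d + 2 := ⟨i.1 - j.1 - 2, by omega⟩
          rw [hd]; simp [b]
        · simp
  rw [Matrix.mulVec, dotProduct]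
  refine ((Finset.sum_congr rfl fun j _ => h j).trans (sum_fin_eq_sum_Icc n F)).trans ?_
  simp only [F]
  rw [Finset.sum_add_distrib, Finset.sum_ite_eq', Finset.sum_ite_eq',
    if_pos (by simp only [Finset.mem_Icc]; omega)]
  have e1 : T.τ (i.1 + 2) * T.b 0 (i.1 + 2) =
      (1 + 2 * T.r (i.1 + 2)) / (1 + T.r (i.1 + 2)) := by
    simp only [b]; field_simp
  have e2 : √(T.τ (i.1 + 2)) * √(T.τ (i.1 + 1)) * T.b 1 (i.1 + 2) = -T.subdiag (i.1 + 2) := by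
    have h1 : √(T.τ (i.1 + 2)) = √(T.r (i.1 + 2)) * √(T.τ (i.1 + 1)) := by
      rw [← Real.sqrt_mul hr.le]
      congr 1
      simp only [r, show i.1 + 2 - 1 = i.1 + 1 by omega]
      field_simp
    have h2 : T.τ (i.1 + 2) = T.r (i.1 + 2) * T.τ (i.1 + 1) := by
      simp only [r, show i.1 + 2 - 1 = i.1 + 1 by omega]
      field_simp
    have h3 := Real.mul_self_sqrt hr.le
    have h4 := Real.mul_self_sqrt hτ'.le
    simp only [b, subdiag]
    rw [h1, h2]
    field_simp
    rw [neg_inj]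
    linear_combination T.r (i.1 + 2) * h4 - T.τ (i.1 + 1) * h3
  split_ifs with h5
  · rw [e1, e2]; ring
  -- First row: the predecessor is level 1, outside the range, where the extension vanishes.
  · have : extend n v (i.1 + 1) = 0 := by
      rw [extend, dif_neg]
      simp only [Finset.mem_Icc] at h5
      omega
    rw [this, e1]; ring

/-- With s = √r the quantity is s³/(1+s²), increasing in s. The number 2.20545 is just above √4.864,
and 1.82936 just above the value there. -/
theorem subdiag_le {k : ℕ} (hr : 0 < T.r k) (hr' : T.r k < 4.864) :
    T.subdiag k ≤ 1.82936 := by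
  rw [subdiag, div_le_iff₀ (by positivity)]
  have h3 := Real.mul_self_sqrt hr.le
  have h4 := Real.sqrt_nonneg (T.r k)
  set s := √(T.r k)
  have h5 : s ≤ 2.20545 := by
    by_contra! h
    nlinarith
  rw [← h3]
  nlinarith [mul_nonneg (mul_nonneg h4 h4) (sub_nonneg.mpr h5), mul_nonneg h4 (sub_nonneg.mpr h5)]

/-- The constant 1.8294 exceeds the 1.82936 of `subdiag_le`; this tiny excess is the source of
coercivity. -/
theorem subdiag_le_diag {k : ℕ} (hr : 0 < T.r k) (hr' : T.r k < 4.864) :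
    1.8294 + T.subdiag k ≤ 2 * ((1 + 2 * T.r k) / (1 + T.r k)) := by
  rw [subdiag, ← mul_div_assoc, ← le_sub_iff_add_le, ← sub_div, le_div_iff₀ (by positivity)]
  have h3 := Real.mul_self_sqrt hr.le
  have h4 := Real.sqrt_nonneg (T.r k)
  set s := √(T.r k)
  have h5 : s ≤ 2.20545 := by
    by_contra! h
    nlinarith
  rw [← h3]
  nlinarith [mul_nonneg (mul_nonneg h4 h4) (sub_nonneg.mpr h5), mul_nonneg h4 (sub_nonneg.mpr h5)]

theorem dotProduct_self_eq_sum_extend {n : ℕ} (v : Fin (n - 1) → ℝ) :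
    v ⬝ᵥ v = ∑ k ∈ Finset.Icc 2 n, extend n v k ^ 2 := by
  rw [← sum_fin_eq_sum_Icc n fun k => extend n v k ^ 2]
  exact Finset.sum_congr rfl fun i _ => by rw [extend_fin, sq]

theorem sum_extend_pred_le {n : ℕ} (v : Fin (n - 1) → ℝ) :
    ∑ k ∈ Finset.Icc 2 n, extend n v (k - 1) ^ 2 ≤ v ⬝ᵥ v := by
  rw [dotProduct_self_eq_sum_extend]
  have h1 : ∑ k ∈ Finset.Icc 2 n, extend n v (k - 1) ^ 2 =
      ∑ k ∈ Finset.Icc 1 (n - 1), extend n v k ^ 2 := by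
    -- The shifted sum runs over levels 1 to n - 1: level 1 contributes zero, and level n is
    -- discarded.
    refine Finset.sum_nbij' (fun k => k - 1) (fun k => k + 1) ?_ ?_ ?_ ?_ ?_ <;>
      · intro k hk
        (try simp only [Finset.mem_Icc] at *) <;> first | rfl | omega
  rw [h1]
  have h2 : ∑ k ∈ Finset.Icc 2 n ∩ Finset.Icc 1 (n - 1), extend n v k ^ 2 =
      ∑ k ∈ Finset.Icc 1 (n - 1), extend n v k ^ 2 := by
    refine Finset.sum_subset Finset.inter_subset_right fun k hk hk' => ?_
    rw [extend, dif_neg, zero_pow two_ne_zero]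
    simp only [Finset.mem_Icc, Finset.mem_inter] at *
    omega
  rw [← h2]
  exact Finset.sum_le_sum_of_subset_of_nonneg Finset.inter_subset_left
    fun _ _ _ => sq_nonneg _

theorem S0.r_lt (h : T.S0 rUser) {k : ℕ} (h1 : 2 ≤ k) (h2 : k ≤ N) : T.r k < 4.864 :=
  (h.2 k h1 h2).2.trans_lt h.1

theorem S0.le_quadForm (h : T.S0 rUser) {n : ℕ} (hn : n ≤ N) (v : Fin (n - 1) → ℝ) :
    0.00002 * (v ⬝ᵥ v) ≤ v ⬝ᵥ (T.Btilde₂ n *ᵥ v) := by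
  have h1 : v ⬝ᵥ (T.Btilde₂ n *ᵥ v) = ∑ k ∈ Finset.Icc 2 n,
      extend n v k * ((1 + 2 * T.r k) / (1 + T.r k) * extend n v k -
        T.subdiag k * extend n v (k - 1)) := by
    rw [← sum_fin_eq_sum_Icc n]
    refine Finset.sum_congr rfl fun i _ => ?_
    rw [Btilde₂_mulVec hn, extend_fin]
    rfl
  -- The coefficients are half of 1.8294 and half of 1.82936. Summed over k, the shifted squares are
  -- absorbed, leaving 0.9147 - 0.91468 = 0.00002.
  have h2 : ∑ k ∈ Finset.Icc 2 n,
      (0.9147 * extend n v k ^ 2 - 0.91468 * extend n v (k - 1) ^ 2) ≤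
      v ⬝ᵥ (T.Btilde₂ n *ᵥ v) := by
    rw [h1]
    refine Finset.sum_le_sum fun k hk => ?_
    rw [Finset.mem_Icc] at hk
    have hr := T.r_pos hk.1 (hk.2.trans hn)
    have hr' := h.r_lt hk.1 (hk.2.trans hn)
    have h3 := subdiag_le hr hr'
    have h4 := subdiag_le_diag hr hr'
    have h5 : 0 ≤ T.subdiag k := by rw [subdiag]; positivity
    set x := extend n v k
    set y := extend n v (k - 1)
    set d := (1 + 2 * T.r k) / (1 + T.r k)
    set e := T.subdiag k
    have h6 : 0 ≤ e * (x - y) ^ 2 := by positivity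
    have h7 : 0 ≤ (2 * d - (1.8294 + e)) * x ^ 2 := mul_nonneg (by linarith) (sq_nonneg x)
    have h8 : 0 ≤ (1.82936 - e) * y ^ 2 := mul_nonneg (by linarith) (sq_nonneg y)
    linarith
  rw [Finset.sum_sub_distrib, ← Finset.mul_sum, ← Finset.mul_sum,
    ← dotProduct_self_eq_sum_extend] at h2
  have h3 := sum_extend_pred_le v
  linarith

theorem S0.norm_mulVec_le (h : T.S0 rUser) {n : ℕ} (hn : n ≤ N) (v : Fin (n - 1) → ℝ) :
    (T.Btilde₂ n *ᵥ v) ⬝ᵥ (T.Btilde₂ n *ᵥ v) ≤ 16 * (v ⬝ᵥ v) := by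
  have h1 : (T.Btilde₂ n *ᵥ v) ⬝ᵥ (T.Btilde₂ n *ᵥ v) = ∑ k ∈ Finset.Icc 2 n,
      ((1 + 2 * T.r k) / (1 + T.r k) * extend n v k -
        T.subdiag k * extend n v (k - 1)) ^ 2 := by
    rw [← sum_fin_eq_sum_Icc n]
    refine Finset.sum_congr rfl fun i _ => ?_
    rw [Btilde₂_mulVec hn, sq]
    rfl
  -- Both the diagonal and the subdiagonal entries are at most 2 in modulus, so (dx - ey)² ≤ 2(4x² +
  -- 4y²).
  have h2 : (T.Btilde₂ n *ᵥ v) ⬝ᵥ (T.Btilde₂ n *ᵥ v) ≤ ∑ k ∈ Finset.Icc 2 n,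
      (8 * extend n v k ^ 2 + 8 * extend n v (k - 1) ^ 2) := by
    rw [h1]
    refine Finset.sum_le_sum fun k hk => ?_
    rw [Finset.mem_Icc] at hk
    have hr := T.r_pos hk.1 (hk.2.trans hn)
    have h3 := subdiag_le hr (h.r_lt hk.1 (hk.2.trans hn))
    have h5 : 0 ≤ T.subdiag k := by rw [subdiag]; positivity
    have h6 : 0 ≤ (1 + 2 * T.r k) / (1 + T.r k) := by positivity
    have h7 : (1 + 2 * T.r k) / (1 + T.r k) ≤ 2 := by
      rw [div_le_iff₀ (by positivity)]; linarith
    set x := extend n v k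
    set y := extend n v (k - 1)
    set d := (1 + 2 * T.r k) / (1 + T.r k)
    set e := T.subdiag k
    have h8 : d ^ 2 ≤ 4 := by nlinarith
    have h9 : e ^ 2 ≤ 4 := by nlinarith
    nlinarith [sq_nonneg (d * x + e * y), mul_nonneg (sub_nonneg.mpr h8) (sq_nonneg x),
      mul_nonneg (sub_nonneg.mpr h9) (sq_nonneg y)]
  rw [Finset.sum_add_distrib, ← Finset.mul_sum, ← Finset.mul_sum,
    ← dotProduct_self_eq_sum_extend] at h2
  have h3 := sum_extend_pred_le v
  linarith

/-- Symmetrising doubles the coercivity constant 0.00002. For the third bound, p = y·Λv satisfies p²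
≤ |y|²|Λv|² ≤ 50000 p|Λv|², and vᵀΘv = 2p. -/
theorem S0.isEigenBound (h : T.S0 rUser) {n : ℕ} (hn : n ≤ N) :
    T.IsEigenBound n 0.00004 16 100000 where
  pos₁ := by norm_num
  pos₂ := by norm_num
  pos₃ := by norm_num
  le_eigenvalue := by
    refine (forall_spectrum_ge_iff (isHermitian_add_transpose (T.Btilde₂ n)) _).mpr fun v => ?_
    rw [dotProduct_add_transpose_mulVec]
    linarith [h.le_quadForm hn v]
  eigenvalue_le := by
    refine (forall_spectrum_le_iff (isHermitian_transpose_mul_self_real _) _).mpr fun v => ?_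
    rw [dotProduct_transpose_mul_self_mulVec]
    exact h.norm_mulVec_le hn v
  quadForm_le := by
    intro v
    obtain ⟨y, hy, hf⟩ := T.exists_dual_vector hn v
    rw [Θ, dotProduct_add_transpose_mulVec, hf v]
    have h1 := sq_dotProduct_le y (T.Λ n *ᵥ v)
    have h2 : 0.00002 * (y ⬝ᵥ y) ≤ y ⬝ᵥ (T.Λ n *ᵥ v) := by
      rw [← hy, Matrix.mulVec_transpose, dotProduct_comm y (_ ᵥ* _), ← Matrix.dotProduct_mulVec]
      exact h.le_quadForm hn y
    have h3 := dotProduct_self_nonneg_real y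
    have h4 := dotProduct_self_nonneg_real (T.Λ n *ᵥ v)
    set p := y ⬝ᵥ (T.Λ n *ᵥ v)
    set a := (T.Λ n *ᵥ v) ⬝ᵥ (T.Λ n *ᵥ v)
    have h5 : 0 ≤ p := by linarith
    rcases h5.eq_or_lt with h6 | h6
    · rw [← h6]; linarith
    · have : p * p ≤ (50000 * a) * p := by nlinarith
      linarith [le_of_mul_le_mul_right this h6]

end TimeMesh

/-! ### Parseval's identity and the spectral estimates -/

section

variable {M : ℕ} [NeZero M] {L : ℝ}

theorem freq_cast_injOn {M : ℕ} (hM : Even M) {ℓ ℓ' : ℤ} (h : ℓ ∈ freq M) (h' : ℓ' ∈ freq M)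
    (he : (ℓ : ZMod M) = (ℓ' : ZMod M)) : ℓ = ℓ' := by
  obtain ⟨K, hK⟩ := hM
  rw [freq, Finset.mem_Ico] at h h'
  have h1 := (ZMod.intCast_eq_intCast_iff_dvd_sub ℓ ℓ' M).mp he
  have h2 := Int.eq_zero_of_abs_lt_dvd h1 (by rw [abs_lt]; constructor <;> omega)
  omega

/-- The sum factors into two character sums on `ZMod M`; distinct frequencies in `freq M` differ by
less than M and so stay distinct modulo M. -/
theorem sum_basisFn_mul_conj (hL : 0 < L) (hM : Even M) {k k' : ℤ × ℤ}
    (hk : k ∈ freq M ×ˢ freq M) (hk' : k' ∈ freq M ×ˢ freq M) :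
    ∑ p : ZMod M × ZMod M, basisFn L k.1 k.2 p * conj (basisFn L k'.1 k'.2 p) =
      if k = k' then (M : ℂ) ^ 2 else 0 := by
  rw [Finset.mem_product] at hk hk'
  let χ : AddChar (ZMod M) ℂ := ZMod.stdAddChar
  have h1 : ∀ p : ZMod M × ZMod M, basisFn L k.1 k.2 p * conj (basisFn L k'.1 k'.2 p) =
      χ (p.1 * ((k.1 : ZMod M) - k'.1)) * χ (p.2 * ((k.2 : ZMod M) - k'.2)) := by
    intro p
    rw [basisFn_eq hL, basisFn_eq hL, ← AddChar.map_neg_eq_conj, ← AddChar.map_add_eq_mul,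
      ← AddChar.map_add_eq_mul]
    congr 1
    ring
  have h2 : ∀ c : ZMod M, ∑ a : ZMod M, χ (a * c) = if c = 0 then (M : ℂ) else 0 := by
    intro c
    have := AddChar.sum_mulShift c (ZMod.isPrimitive_stdAddChar M)
    simpa [ZMod.card] using this
  simp_rw [h1]
  rw [Fintype.sum_prod_type]
  dsimp only
  rw [← Finset.sum_mul_sum, h2, h2]
  have h3 : (k.1 : ZMod M) - k'.1 = 0 ↔ k.1 = k'.1 := by
    rw [sub_eq_zero]
    exact ⟨freq_cast_injOn hM hk.1 hk'.1, fun h => by rw [h]⟩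
  have h4 : (k.2 : ZMod M) - k'.2 = 0 ↔ k.2 = k'.2 := by
    rw [sub_eq_zero]
    exact ⟨freq_cast_injOn hM hk.2 hk'.2, fun h => by rw [h]⟩
  simp only [h3, h4, Prod.ext_iff]
  split_ifs <;> first | (exfalso; tauto) | simp [sq]

/-- The trigonometric polynomial with the coefficients `a`. -/
def synth (L : ℝ) (a : ℤ × ℤ → ℂ) (p : ZMod M × ZMod M) : ℂ :=
  ∑ k ∈ freq M ×ˢ freq M, a k * basisFn L k.1 k.2 p

theorem sum_synth_mul_conj (hL : 0 < L) (hM : Even M) (a b : ℤ × ℤ → ℂ) :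
    ∑ p : ZMod M × ZMod M, synth L a p * conj (synth L b p) =
      (M : ℂ) ^ 2 * ∑ k ∈ freq M ×ˢ freq M, a k * conj (b k) := by
  simp_rw [synth, map_sum, map_mul, Finset.sum_mul_sum]
  rw [Finset.sum_comm, Finset.mul_sum]
  refine Finset.sum_congr rfl fun k hk => ?_
  rw [Finset.sum_comm]
  have h : ∀ k' ∈ freq M ×ˢ freq M,
      ∑ p : ZMod M × ZMod M, a k * basisFn L k.1 k.2 p *
        (conj (b k') * conj (basisFn L k'.1 k'.2 p)) =
      if k = k' then (M : ℂ) ^ 2 * (a k * conj (b k')) else 0 := by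
    intro k' hk'
    have := sum_basisFn_mul_conj (L := L) hL hM hk hk'
    calc _ = (a k * conj (b k')) * ∑ p : ZMod M × ZMod M,
          basisFn L k.1 k.2 p * conj (basisFn L k'.1 k'.2 p) := by
          rw [Finset.mul_sum]
          exact Finset.sum_congr rfl fun p _ => by ring
      _ = _ := by
          rw [this]
          split_ifs <;> ring
  rw [Finset.sum_congr rfl h, Finset.sum_ite_eq, if_pos hk]

theorem sum_norm_synth_sq (hL : 0 < L) (hM : Even M) (a : ℤ × ℤ → ℂ) :
    ∑ p : ZMod M × ZMod M, ‖synth L a p‖ ^ 2 =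
      (M : ℝ) ^ 2 * ∑ k ∈ freq M ×ˢ freq M, ‖a k‖ ^ 2 := by
  have h := sum_synth_mul_conj (L := L) hL hM a a
  simp only [Complex.mul_conj, Complex.normSq_eq_norm_sq] at h
  exact_mod_cast h

/-- The coefficients of a grid function, as a function of the wave vector. -/
def coeffs (L : ℝ) (v : GridFn M) (k : ℤ × ℤ) : ℂ := coeff L v k.1 k.2

theorem synth_coeffs (hL : 0 < L) (hM : Even M) (v : GridFn M) (p : ZMod M × ZMod M) :
    synth L (coeffs L v) p = v p := by
  rw [synth, Finset.sum_product]
  exact sum_coeff_mul_basisFn hL hM v p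

theorem Dx_eq_synth (v : GridFn M) (p : ZMod M × ZMod M) :
    Dx L v p = synth L
      (fun k => Complex.I * ((2 * Real.pi / L * k.1 : ℝ) : ℂ) * coeffs L v k) p := by
  rw [synth, Finset.sum_product]; rfl

theorem Dy_eq_synth (v : GridFn M) (p : ZMod M × ZMod M) :
    Dy L v p = synth L
      (fun k => Complex.I * ((2 * Real.pi / L * k.2 : ℝ) : ℂ) * coeffs L v k) p := by
  rw [synth, Finset.sum_product]; rfl

theorem lap_eq_synth (hL : 0 < L) (hM : Even M) (v : GridFn M) (p : ZMod M × ZMod M) :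
    ((lap L v p : ℝ) : ℂ) = synth L
      (fun k => -(((2 * Real.pi / L) ^ 2 * ((k.1 : ℝ) ^ 2 + (k.2 : ℝ) ^ 2) : ℝ) : ℂ) *
        coeffs L v k) p := by
  rw [ofReal_lap hL hM, Dxx, Dyy, synth, Finset.sum_product, ← Finset.sum_add_distrib]
  refine Finset.sum_congr rfl fun ℓ _ => ?_
  rw [← Finset.sum_add_distrib]
  refine Finset.sum_congr rfl fun m _ => ?_
  simp only [coeffs, mul_pow, Complex.I_sq]
  push_cast
  ring

theorem sum_norm_Dx_sq (hL : 0 < L) (hM : Even M) (v : GridFn M) :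
    ∑ p, ‖Dx L v p‖ ^ 2 = (M : ℝ) ^ 2 * ∑ k ∈ freq M ×ˢ freq M,
      (2 * Real.pi / L) ^ 2 * (k.1 : ℝ) ^ 2 * ‖coeffs L v k‖ ^ 2 := by
  simp_rw [Dx_eq_synth]
  rw [sum_norm_synth_sq hL hM]
  congr 1
  refine Finset.sum_congr rfl fun k _ => ?_
  rw [norm_mul, norm_mul, Complex.norm_I, one_mul, Complex.norm_real, mul_pow, Real.norm_eq_abs,
    sq_abs, mul_pow]

theorem sum_norm_Dy_sq (hL : 0 < L) (hM : Even M) (v : GridFn M) :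
    ∑ p, ‖Dy L v p‖ ^ 2 = (M : ℝ) ^ 2 * ∑ k ∈ freq M ×ˢ freq M,
      (2 * Real.pi / L) ^ 2 * (k.2 : ℝ) ^ 2 * ‖coeffs L v k‖ ^ 2 := by
  simp_rw [Dy_eq_synth]
  rw [sum_norm_synth_sq hL hM]
  congr 1
  refine Finset.sum_congr rfl fun k _ => ?_
  rw [norm_mul, norm_mul, Complex.norm_I, one_mul, Complex.norm_real, mul_pow, Real.norm_eq_abs,
    sq_abs, mul_pow]

theorem sum_sq_eq (hL : 0 < L) (hM : Even M) (v : GridFn M) :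
    ∑ p, v p ^ 2 = (M : ℝ) ^ 2 * ∑ k ∈ freq M ×ˢ freq M, ‖coeffs L v k‖ ^ 2 := by
  rw [← sum_norm_synth_sq hL hM]
  refine Finset.sum_congr rfl fun p _ => ?_
  rw [synth_coeffs hL hM, Complex.norm_real, Real.norm_eq_abs, sq_abs]

/-- Summation by parts: `‖∇_h v‖² = -⟨v, Δ_h v⟩`. -/
theorem sum_mul_lap (hL : 0 < L) (hM : Even M) (v : GridFn M) :
    ∑ p, (‖Dx L v p‖ ^ 2 + ‖Dy L v p‖ ^ 2) = -∑ p, lap L v p * v p := by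
  have h := sum_synth_mul_conj (L := L) hL hM
    (fun k => -(((2 * Real.pi / L) ^ 2 * ((k.1 : ℝ) ^ 2 + (k.2 : ℝ) ^ 2) : ℝ) : ℂ) *
        coeffs L v k) (coeffs L v)
  simp_rw [← lap_eq_synth hL hM v, synth_coeffs hL hM v, mul_assoc, Complex.mul_conj,
    Complex.normSq_eq_norm_sq, Complex.conj_ofReal] at h
  have h' : ∑ p, lap L v p * v p = (M : ℝ) ^ 2 * ∑ k ∈ freq M ×ˢ freq M,
      -((2 * Real.pi / L) ^ 2 * ((k.1 : ℝ) ^ 2 + (k.2 : ℝ) ^ 2)) * ‖coeffs L v k‖ ^ 2 := by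
    exact_mod_cast h
  rw [h', Finset.sum_add_distrib, sum_norm_Dx_sq hL hM, sum_norm_Dy_sq hL hM, ← mul_add,
    ← Finset.sum_add_distrib, ← mul_neg, ← Finset.sum_neg_distrib]
  congr 1
  refine Finset.sum_congr rfl fun k _ => ?_
  ring

/-- The discrete Poincaré inequality. -/
theorem poincare (hL : 0 < L) (hM : Even M) (v : GridFn M) (hv : MeanZero L v) :
    (2 * Real.pi / L) ^ 2 * ∑ p, v p ^ 2 ≤ ∑ p, (‖Dx L v p‖ ^ 2 + ‖Dy L v p‖ ^ 2) := by
  rw [Finset.sum_add_distrib, sum_norm_Dx_sq hL hM, sum_norm_Dy_sq hL hM, sum_sq_eq hL hM,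
    ← mul_add, ← Finset.sum_add_distrib, mul_left_comm, Finset.mul_sum]
  refine mul_le_mul_of_nonneg_left (Finset.sum_le_sum fun k _ => ?_) (by positivity)
  rw [← add_mul, ← mul_add, mul_assoc]
  refine mul_le_mul_of_nonneg_left ?_ (by positivity)
  -- The zero mode is the mean, which vanishes; every other integer wave vector has squared length
  -- at least 1.
  by_cases hk : k = 0
  · have hM0 : (M : ℝ) ≠ 0 := Nat.cast_ne_zero.mpr (NeZero.ne M)
    have h0 : ∑ p, v p = 0 := by
      rw [MeanZero, gInner, meshLen] at hv
      have : (L / M) ^ 2 ≠ 0 := by positivity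
      simpa using (mul_eq_zero.mp hv).resolve_left this
    have h1 : coeffs L v k = 0 := by
      subst hk
      have h2 : ∀ p : ZMod M × ZMod M, basisFn L 0 0 p = 1 := fun p => by
        rw [basisFn]; simp
      simp only [coeffs, coeff, Prod.fst_zero, Prod.snd_zero, h2, map_one, mul_one]
      rw [← Complex.ofReal_sum, h0]
      simp
    simp [h1]
  · have h1 : 1 ≤ k.1 ^ 2 + k.2 ^ 2 := by
      by_contra! h
      have h2 : k.1 = 0 := by nlinarith
      have h3 : k.2 = 0 := by nlinarith
      exact hk (Prod.ext h2 h3)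
    have h2 : (1 : ℝ) ≤ (k.1 : ℝ) ^ 2 + (k.2 : ℝ) ^ 2 := by exact_mod_cast h1
    nlinarith [sq_nonneg ‖coeffs L v k‖]

theorem norm_stdAddChar_sub_one_le (ℓ : ℤ) :
    ‖(ZMod.stdAddChar (ℓ : ZMod M) : ℂ) - 1‖ ≤ 2 * Real.pi / M * |(ℓ : ℝ)| := by
  rw [ZMod.stdAddChar_coe]
  have h := Real.norm_exp_I_mul_ofReal_sub_one_le (x := 2 * Real.pi / M * ℓ)
  rw [Real.norm_eq_abs, abs_mul, abs_of_nonneg (by positivity)] at h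
  convert h using 4
  push_cast
  ring

/-- Forward differences are dominated by the spectral derivative. -/
theorem sum_forward_diff_fst_sq_le (hL : 0 < L) (hM : Even M) (v : GridFn M) :
    ∑ p : ZMod M × ZMod M, (v (p.1 + 1, p.2) - v p) ^ 2 ≤
      meshLen L M ^ 2 * ∑ p, ‖Dx L v p‖ ^ 2 := by
  have hM0 : (M : ℝ) ≠ 0 := Nat.cast_ne_zero.mpr (NeZero.ne M)
  -- A grid shift multiplies each mode by a character value, so the forward difference is a Fourier
  -- multiplier comparable mode by mode with iνℓ.
  have h1 : ∀ p : ZMod M × ZMod M, (v (p.1 + 1, p.2) - v p) ^ 2 =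
      ‖synth L (fun k => (ZMod.stdAddChar (k.1 : ZMod M) - 1) * coeffs L v k) p‖ ^ 2 := by
    intro p
    rw [← sq_abs, ← Real.norm_eq_abs, ← Complex.norm_real, Complex.ofReal_sub,
      ← synth_coeffs hL hM, ← synth_coeffs hL hM, synth, synth, synth, ← Finset.sum_sub_distrib]
    congr 2
    refine Finset.sum_congr rfl fun k _ => ?_
    rw [basisFn_eq hL, basisFn_eq hL]
    dsimp only
    rw [mul_add, mul_one, add_right_comm, AddChar.map_add_eq_mul _ _ (k.1 : ZMod M)]
    ring
  simp_rw [h1]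
  rw [sum_norm_synth_sq hL hM, sum_norm_Dx_sq hL hM, mul_left_comm]
  refine mul_le_mul_of_nonneg_left ?_ (by positivity)
  rw [Finset.mul_sum]
  refine Finset.sum_le_sum fun k _ => ?_
  rw [norm_mul, mul_pow, ← mul_assoc]
  refine mul_le_mul_of_nonneg_right ?_ (by positivity)
  calc _ ≤ (2 * Real.pi / M * |(k.1 : ℝ)|) ^ 2 :=
        pow_le_pow_left₀ (norm_nonneg _) (norm_stdAddChar_sub_one_le k.1) 2
    _ = _ := by
        rw [mul_pow, sq_abs, meshLen]
        field_simp

theorem sum_forward_diff_snd_sq_le (hL : 0 < L) (hM : Even M) (v : GridFn M) :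
    ∑ p : ZMod M × ZMod M, (v (p.1, p.2 + 1) - v p) ^ 2 ≤
      meshLen L M ^ 2 * ∑ p, ‖Dy L v p‖ ^ 2 := by
  have hM0 : (M : ℝ) ≠ 0 := Nat.cast_ne_zero.mpr (NeZero.ne M)
  have h1 : ∀ p : ZMod M × ZMod M, (v (p.1, p.2 + 1) - v p) ^ 2 =
      ‖synth L (fun k => (ZMod.stdAddChar (k.2 : ZMod M) - 1) * coeffs L v k) p‖ ^ 2 := by
    intro p
    rw [← sq_abs, ← Real.norm_eq_abs, ← Complex.norm_real, Complex.ofReal_sub,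
      ← synth_coeffs hL hM, ← synth_coeffs hL hM, synth, synth, synth, ← Finset.sum_sub_distrib]
    congr 2
    refine Finset.sum_congr rfl fun k _ => ?_
    rw [basisFn_eq hL, basisFn_eq hL]
    dsimp only
    rw [mul_add, mul_one, ← add_assoc, AddChar.map_add_eq_mul _ _ (k.2 : ZMod M)]
    ring
  simp_rw [h1]
  rw [sum_norm_synth_sq hL hM, sum_norm_Dy_sq hL hM, mul_left_comm]
  refine mul_le_mul_of_nonneg_left ?_ (by positivity)
  rw [Finset.mul_sum]
  refine Finset.sum_le_sum fun k _ => ?_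
  rw [norm_mul, mul_pow, ← mul_assoc]
  refine mul_le_mul_of_nonneg_right ?_ (by positivity)
  calc _ ≤ (2 * Real.pi / M * |(k.2 : ℝ)|) ^ 2 :=
        pow_le_pow_left₀ (norm_nonneg _) (norm_stdAddChar_sub_one_le k.2) 2
    _ = _ := by
        rw [mul_pow, sq_abs, meshLen]
        field_simp

end

/-! ### The discrete Sobolev embedding -/

section

variable {M : ℕ} [NeZero M] {L : ℝ}

theorem sum_range_natCast_zmod (F : ZMod M → ℝ) : ∑ l ∈ Finset.range M, F l = ∑ a, F a := by
  refine Finset.sum_nbij' (fun l => (l : ZMod M)) (fun a => a.val) ?_ ?_ ?_ ?_ ?_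
  · intro l _; exact Finset.mem_univ _
  · intro a _; exact Finset.mem_range.mpr (ZMod.val_lt a)
  · intro l hl; exact ZMod.val_cast_of_lt (Finset.mem_range.mp hl)
  · intro a _; exact ZMod.natCast_zmod_val a
  · intro l _; rfl

/-- Walk from j to i in unit steps around the circle; fewer than M steps are needed, so a full turn
dominates. -/
theorem sub_le_sum_abs_forward_diff (g : ZMod M → ℝ) (i j : ZMod M) :
    g i - g j ≤ ∑ a, |g (a + 1) - g a| := by
  have h1 : ∀ k : ℕ, g (j + k) - g j ≤
      ∑ l ∈ Finset.range k, |g (j + l + 1) - g (j + l)| := by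
    intro k
    induction k with
    | zero => simp
    | succ k ih =>
      rw [Finset.sum_range_succ, Nat.cast_succ, ← add_assoc]
      linarith [le_abs_self (g (j + k + 1) - g (j + k))]
  have h2 := h1 (i - j).val
  rw [ZMod.natCast_zmod_val, add_sub_cancel] at h2
  refine h2.trans ?_
  calc _ ≤ ∑ l ∈ Finset.range M, |g (j + l + 1) - g (j + l)| :=
        Finset.sum_le_sum_of_subset_of_nonneg
          (Finset.range_subset_range.mpr (ZMod.val_lt _).le) fun _ _ _ => abs_nonneg _
    _ = ∑ a, |g (j + a + 1) - g (j + a)| :=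
        sum_range_natCast_zmod fun a => |g (j + a + 1) - g (j + a)|
    _ = _ := Equiv.sum_comp (Equiv.addLeft j) fun a => |g (a + 1) - g a|

/-- A periodic grid function is bounded by its mean plus its total variation. -/
theorem le_mean_add_variation (g : ZMod M → ℝ) (i : ZMod M) :
    g i ≤ (∑ a, g a) / M + ∑ a, |g (a + 1) - g a| := by
  have hM0 : (0 : ℝ) < M := Nat.cast_pos.mpr (Nat.pos_of_ne_zero (NeZero.ne M))
  -- Averaging the pointwise bound over the base point j produces the mean.
  have h : ∑ j : ZMod M, g i ≤ ∑ j : ZMod M, (g j + ∑ a, |g (a + 1) - g a|) :=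
    Finset.sum_le_sum fun j _ => by linarith [sub_le_sum_abs_forward_diff g i j]
  rw [Finset.sum_add_distrib, Finset.sum_const, Finset.sum_const, Finset.card_univ, ZMod.card,
    nsmul_eq_mul, nsmul_eq_mul] at h
  rw [div_add' _ _ _ hM0.ne', le_div_iff₀ hM0]
  linarith

/-- The discrete Gagliardo inequality on the two-dimensional periodic grid. -/
theorem sum_sq_le_gagliardo (f : GridFn M) (hf : ∀ p, 0 ≤ f p) :
    ∑ p, f p ^ 2 ≤
      ((∑ p, f p) / M + ∑ p : ZMod M × ZMod M, |f (p.1 + 1, p.2) - f p|) *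
      ((∑ p, f p) / M + ∑ p : ZMod M × ZMod M, |f (p.1, p.2 + 1) - f p|) := by
  -- One-dimensional bounds along the two directions give f(i,j)² ≤ A(j)B(i), and the double sum of
  -- the right side factors.
  let A : ZMod M → ℝ := fun j => (∑ i, f (i, j)) / M + ∑ i, |f (i + 1, j) - f (i, j)|
  let B : ZMod M → ℝ := fun i => (∑ j, f (i, j)) / M + ∑ j, |f (i, j + 1) - f (i, j)|
  have hA : ∀ i j, f (i, j) ≤ A j := fun i j => le_mean_add_variation (fun a => f (a, j)) i
  have hB : ∀ i j, f (i, j) ≤ B i := fun i j => le_mean_add_variation (fun a => f (i, a)) j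
  have hAs : ∑ j, A j =
      (∑ p, f p) / M + ∑ p : ZMod M × ZMod M, |f (p.1 + 1, p.2) - f p| := by
    rw [Finset.sum_add_distrib, ← Finset.sum_div, Fintype.sum_prod_type_right,
      Fintype.sum_prod_type_right]
  have hBs : ∑ i, B i =
      (∑ p, f p) / M + ∑ p : ZMod M × ZMod M, |f (p.1, p.2 + 1) - f p| := by
    rw [Finset.sum_add_distrib, ← Finset.sum_div, Fintype.sum_prod_type, Fintype.sum_prod_type]
  rw [← hAs, ← hBs, mul_comm, Finset.sum_mul_sum, Fintype.sum_prod_type]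
  refine Finset.sum_le_sum fun i _ => Finset.sum_le_sum fun j _ => ?_
  rw [sq]
  exact mul_le_mul (hB i j) (hA i j) (hf _) ((hf (i, j)).trans (hB i j))

theorem sum_abs_mul_le_sqrt {ι : Type*} [Fintype ι] (w d : ι → ℝ) :
    ∑ p, w p * |d p| ≤ √(∑ p, w p ^ 2) * √(∑ p, d p ^ 2) := by
  have := Real.sum_mul_le_sqrt_mul_sqrt Finset.univ w fun p => |d p|
  simpa only [sq_abs] using this

/-- The variation of `f` along a shift `σ` of the grid. -/
theorem sum_abs_shift_sub_le {ι : Type*} [Fintype ι] (σ : Equiv.Perm ι) (v w f : ι → ℝ)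
    (h : ∀ p q, |f q - f p| ≤ (w p + w q) * |v q - v p|) :
    ∑ p, |f (σ p) - f p| ≤ 2 * (√(∑ p, w p ^ 2) * √(∑ p, (v (σ p) - v p) ^ 2)) := by
  have h1 := sum_abs_mul_le_sqrt w fun p => v (σ p) - v p
  have h2 := sum_abs_mul_le_sqrt (fun p => w (σ p)) fun p => v (σ p) - v p
  rw [Equiv.sum_comp σ fun p => w p ^ 2] at h2
  calc _ ≤ ∑ p, (w p * |v (σ p) - v p| + w (σ p) * |v (σ p) - v p|) :=
        Finset.sum_le_sum fun p _ => by
          rw [← add_mul]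
          exact h p (σ p)
    _ ≤ _ := by
        rw [Finset.sum_add_distrib]
        linarith

/-- The unnormalised square of the `H¹` seminorm. -/
def gradSum (L : ℝ) (v : GridFn M) : ℝ := ∑ p, (‖Dx L v p‖ ^ 2 + ‖Dy L v p‖ ^ 2)

theorem gradSum_nonneg (v : GridFn M) : 0 ≤ gradSum L v :=
  Finset.sum_nonneg fun _ _ => by positivity

theorem sum_sq_le_gradSum (hL : 0 < L) (hM : Even M) {v : GridFn M} (hv : MeanZero L v) :
    ∑ p, v p ^ 2 ≤ L ^ 2 * gradSum L v := by
  have h4 := poincare hL hM v hv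
  have h5 : L ^ 2 * (2 * Real.pi / L) ^ 2 = (2 * Real.pi) ^ 2 := by field_simp
  have h6 : (1 : ℝ) ≤ (2 * Real.pi) ^ 2 := by nlinarith [Real.pi_gt_three]
  have h7 : 0 ≤ ∑ p, v p ^ 2 := Finset.sum_nonneg fun _ _ => sq_nonneg _
  calc ∑ p, v p ^ 2 ≤ (2 * Real.pi) ^ 2 * ∑ p, v p ^ 2 := le_mul_of_one_le_left h7 h6
    _ = L ^ 2 * ((2 * Real.pi / L) ^ 2 * ∑ p, v p ^ 2) := by rw [← h5]; ring
    _ ≤ L ^ 2 * gradSum L v := mul_le_mul_of_nonneg_left h4 (by positivity)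

/-- One step of the bootstrap from `l²` to `l⁴` and from `l⁴` to `l⁶`. -/
theorem sum_sq_le_of_variation (hL : 0 < L) (hM : Even M) {v : GridFn M} (hv : MeanZero L v)
    {f w : GridFn M} (hf : ∀ p, 0 ≤ f p) (hfw : ∀ p, f p ≤ w p * |v p|)
    (h : ∀ p q, |f q - f p| ≤ (w p + w q) * |v q - v p|) :
    ∑ p, f p ^ 2 ≤ 9 * meshLen L M ^ 2 * gradSum L v * ∑ p, w p ^ 2 := by
  have hM0 : (0 : ℝ) < M := Nat.cast_pos.mpr (Nat.pos_of_ne_zero (NeZero.ne M))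
  have hh : 0 < meshLen L M := div_pos hL hM0
  have hG := gradSum_nonneg (L := L) v
  set W := √(∑ p, w p ^ 2) with hW
  set X := meshLen L M * √(gradSum L v) with hX
  have hX0 : 0 ≤ X := by positivity
  have hW0 : 0 ≤ W := Real.sqrt_nonneg _
  have hXs : √(meshLen L M ^ 2 * gradSum L v) = X := by
    rw [Real.sqrt_mul (by positivity), Real.sqrt_sq hh.le]
  -- Poincaré's factor L divided by M is the mesh length, so the mean term has the same size WX as
  -- the variation. Each variation costs 2WX, hence the factor 3² = 9.
  have h1 : (∑ p, f p) / M ≤ W * X := by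
    have h2 := (Finset.sum_le_sum fun p (_ : p ∈ Finset.univ) => hfw p).trans
      (sum_abs_mul_le_sqrt w v)
    have h3 : √(∑ p, v p ^ 2) ≤ M * X := by
      rw [← hXs]
      refine Real.sqrt_le_iff.mpr ⟨by positivity, ?_⟩
      rw [mul_pow, Real.sq_sqrt (by positivity), meshLen]
      calc _ ≤ _ := sum_sq_le_gradSum hL hM hv
        _ = _ := by field_simp
    rw [div_le_iff₀ hM0]
    calc _ ≤ _ := h2
      _ ≤ W * (M * X) := mul_le_mul_of_nonneg_left h3 hW0
      _ = _ := by ring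
  have hx : √(∑ p : ZMod M × ZMod M, (v (p.1 + 1, p.2) - v p) ^ 2) ≤ X := by
    rw [← hXs]
    refine Real.sqrt_le_sqrt ((sum_forward_diff_fst_sq_le hL hM v).trans ?_)
    exact mul_le_mul_of_nonneg_left
      (Finset.sum_le_sum fun p _ => by nlinarith [sq_nonneg ‖Dy L v p‖])
      (by positivity)
  have hy : √(∑ p : ZMod M × ZMod M, (v (p.1, p.2 + 1) - v p) ^ 2) ≤ X := by
    rw [← hXs]
    refine Real.sqrt_le_sqrt ((sum_forward_diff_snd_sq_le hL hM v).trans ?_)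
    exact mul_le_mul_of_nonneg_left
      (Finset.sum_le_sum fun p _ => by nlinarith [sq_nonneg ‖Dx L v p‖])
      (by positivity)
  have h2 := sum_abs_shift_sub_le
    ((Equiv.addRight (1 : ZMod M)).prodCongr (Equiv.refl (ZMod M))) v w f h
  have h3 := sum_abs_shift_sub_le
    ((Equiv.refl (ZMod M)).prodCongr (Equiv.addRight (1 : ZMod M))) v w f h
  have h2' : ∑ p : ZMod M × ZMod M, |f (p.1 + 1, p.2) - f p| ≤ 2 * (W * X) :=
    h2.trans (by gcongr; exact hx)
  have h3' : ∑ p : ZMod M × ZMod M, |f (p.1, p.2 + 1) - f p| ≤ 2 * (W * X) :=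
    h3.trans (by gcongr; exact hy)
  have hf0 : 0 ≤ (∑ p, f p) / M := div_nonneg (Finset.sum_nonneg fun p _ => hf p) hM0.le
  have h4 : 0 ≤ ∑ p : ZMod M × ZMod M, |f (p.1, p.2 + 1) - f p| :=
    Finset.sum_nonneg fun _ _ => abs_nonneg _
  calc _ ≤ _ := sum_sq_le_gagliardo f hf
    _ ≤ (W * X + 2 * (W * X)) * (W * X + 2 * (W * X)) :=
        mul_le_mul (add_le_add h1 h2') (add_le_add h1 h3') (add_nonneg hf0 h4) (by positivity)
    _ = 9 * (X ^ 2) * W ^ 2 := by ring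
    _ = _ := by
        rw [hX, hW, mul_pow, Real.sq_sqrt hG,
          Real.sq_sqrt (Finset.sum_nonneg fun _ _ => sq_nonneg _)]
        ring

/-- From b² + |ab| + a² ≤ (3/2)(a² + b²); the split into one weight per endpoint is the form the
bootstrap step requires. -/
theorem abs_abs_cube_sub_le (a b : ℝ) :
    |(|b| ^ 3 - |a| ^ 3)| ≤ (3 / 2 * a ^ 2 + 3 / 2 * b ^ 2) * |b - a| := by
  have h : |b| ^ 3 - |a| ^ 3 = (|b| ^ 2 + |b| * |a| + |a| ^ 2) * (|b| - |a|) := by ring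
  rw [h, abs_mul, abs_of_nonneg (by positivity)]
  refine mul_le_mul ?_ (abs_abs_sub_abs_le b a) (abs_nonneg _) (by positivity)
  nlinarith [sq_nonneg (|b| - |a|), sq_abs a, sq_abs b]

/-- Two rounds of the bootstrap, with weights |v| and (3/2)v², followed by Poincaré: 9 · (9/4) · 9 =
729/4. -/
theorem sum_pow_six_le (hL : 0 < L) (hM : Even M) {v : GridFn M} (hv : MeanZero L v) :
    ∑ p, |v p| ^ 6 ≤ 729 / 4 * L ^ 2 * meshLen L M ^ 4 * gradSum L v ^ 3 := by
  have hG := gradSum_nonneg (L := L) v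
  have h2 := sum_sq_le_gradSum hL hM hv
  have h4 := sum_sq_le_of_variation hL hM hv (f := fun p => v p ^ 2) (w := fun p => |v p|)
    (fun p => sq_nonneg _) (fun p => by rw [← sq, sq_abs]) fun p q => by
      rw [sq_sub_sq, abs_mul]
      exact mul_le_mul_of_nonneg_right ((abs_add_le _ _).trans (by rw [add_comm])) (abs_nonneg _)
  have h6 := sum_sq_le_of_variation hL hM hv (f := fun p => |v p| ^ 3)
    (w := fun p => 3 / 2 * v p ^ 2) (fun p => by positivity)
    (fun p => by
      have : 0 ≤ |v p| ^ 3 := by positivity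
      rw [← sq_abs, mul_assoc, ← pow_succ]
      linarith) fun p q => abs_abs_cube_sub_le _ _
  simp only [sq_abs, mul_pow, ← pow_mul, ← Finset.mul_sum, Nat.reduceMul] at h4 h6
  calc _ ≤ _ := h6
    _ ≤ 9 * meshLen L M ^ 2 * gradSum L v *
        ((3 / 2) ^ 2 * (9 * meshLen L M ^ 2 * gradSum L v * (L ^ 2 * gradSum L v))) := by
        gcongr
        exact h4.trans (by gcongr)
    _ = _ := by ring

theorem gradNorm_eq (v : GridFn M) : gradNorm L v = √(meshLen L M ^ 2 * gradSum L v) := rfl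

theorem isEmbeddingConst (hL : 0 < L) (hM : Even M) :
    IsEmbeddingConst L M ((729 / 4 * L ^ 2) ^ ((1 : ℝ) / 6)) := by
  refine ⟨by positivity, fun v hv => ?_⟩
  have hG := gradSum_nonneg (L := L) v
  have h := sum_pow_six_le hL hM hv
  have hg : 0 ≤ gradNorm L v := Real.sqrt_nonneg _
  have hg6 : gradNorm L v ^ 6 = (meshLen L M ^ 2 * gradSum L v) ^ 3 := by
    rw [gradNorm_eq, show 6 = 2 * 3 by norm_num, pow_mul, Real.sq_sqrt (by positivity)]
  have hg' : gradNorm L v = (gradNorm L v ^ 6) ^ ((1 : ℝ) / 6) := by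
    rw [one_div]
    exact (Real.pow_rpow_inv_natCast hg (by norm_num : 6 ≠ 0)).symm
  rw [hg', ← Real.mul_rpow (by positivity) (by positivity), lqNorm]
  refine Real.rpow_le_rpow (by positivity) ?_ (by norm_num)
  have h6 : ∀ p, |v p| ^ (6 : ℝ) = |v p| ^ 6 := fun p => Real.rpow_natCast _ 6
  simp_rw [h6]
  -- The powers of h combine exactly into `gradNorm` to the sixth, which is why the constant does
  -- not depend on M.
  calc _ ≤ meshLen L M ^ 2 * _ := mul_le_mul_of_nonneg_left h (by positivity)
    _ = _ := by rw [hg6]; ring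

end

/-! ### The convolution inequality -/

section

variable {M : ℕ} [NeZero M] {L : ℝ}

/-- Hölder's inequality `‖u w‖ ≤ ‖u‖_{l³} ‖w‖_{l⁶}`. -/
theorem gInner_mul_self_le (u w : GridFn M) :
    gInner L (u * w) (u * w) ≤ lqNorm L 3 u ^ 2 * lqNorm L 6 w ^ 2 := by
  have hpq : (3 / 2 : ℝ).HolderConjugate 3 := by
    rw [Real.holderConjugate_iff]; norm_num
  have h := Real.inner_le_Lp_mul_Lq Finset.univ (fun p => |u p| ^ 2) (fun p => |w p| ^ 2) hpq
  have e1 : ∀ p, |(|u p| ^ 2)| ^ (3 / 2 : ℝ) = |u p| ^ (3 : ℝ) := fun p => by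
    rw [abs_of_nonneg (by positivity), ← Real.rpow_natCast, ← Real.rpow_mul (abs_nonneg _)]
    norm_num
  have e2 : ∀ p, |(|w p| ^ 2)| ^ (3 : ℝ) = |w p| ^ (6 : ℝ) := fun p => by
    rw [abs_of_nonneg (by positivity), ← Real.rpow_natCast, ← Real.rpow_mul (abs_nonneg _)]
    norm_num
  simp_rw [e1, e2] at h
  have hA : 0 ≤ ∑ p, |u p| ^ (3 : ℝ) := Finset.sum_nonneg fun _ _ => by positivity
  have hB : 0 ≤ ∑ p, |w p| ^ (6 : ℝ) := Finset.sum_nonneg fun _ _ => by positivity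
  have hh : 0 ≤ meshLen L M ^ 2 := sq_nonneg _
  rw [lqNorm, lqNorm, ← Real.rpow_mul_natCast (mul_nonneg hh hA),
    ← Real.rpow_mul_natCast (mul_nonneg hh hB),
    Real.mul_rpow hh hA, Real.mul_rpow hh hB, gInner]
  -- The exponents 2/3 and 1/3 add up to 1, so the mesh weights of the two norms match that of the
  -- inner product.
  have e3 : (meshLen L M ^ 2) ^ (1 / (3 : ℝ) * (2 : ℕ)) *
      (meshLen L M ^ 2) ^ (1 / (6 : ℝ) * (2 : ℕ)) = meshLen L M ^ 2 := by
    rw [← Real.rpow_add_of_nonneg hh (by positivity) (by positivity)]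
    norm_num
  have e4 : ∑ p, (u * w) p * (u * w) p = ∑ p, |u p| ^ 2 * |w p| ^ 2 :=
    Finset.sum_congr rfl fun p _ => by
      rw [sq_abs, sq_abs, Pi.mul_apply]; ring
  calc _ ≤ meshLen L M ^ 2 * _ := mul_le_mul_of_nonneg_left (e4.trans_le h) hh
    _ = ((meshLen L M ^ 2) ^ (1 / (3 : ℝ) * (2 : ℕ)) *
      (meshLen L M ^ 2) ^ (1 / (6 : ℝ) * (2 : ℕ))) * _ := by rw [e3]
    _ = _ := by
      norm_num
      ring

theorem gInner_self_nonneg (v : GridFn M) : 0 ≤ gInner L v v :=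
  mul_nonneg (sq_nonneg _) (Finset.sum_nonneg fun p _ => mul_self_nonneg (v p))

theorem gNorm_sq (v : GridFn M) : gNorm L v ^ 2 = gInner L v v :=
  Real.sq_sqrt (gInner_self_nonneg v)

theorem lqNorm_nonneg (q : ℝ) (v : GridFn M) : 0 ≤ lqNorm L q v :=
  Real.rpow_nonneg (mul_nonneg (sq_nonneg _) (Finset.sum_nonneg fun _ _ => by positivity)) _

theorem abs_gInner_le (v w : GridFn M) : |gInner L v w| ≤ gNorm L v * gNorm L w := by
  refine abs_le_of_sq_le_sq ?_ (mul_nonneg (Real.sqrt_nonneg _) (Real.sqrt_nonneg _))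
  rw [mul_pow, gNorm_sq, gNorm_sq, gInner, gInner, gInner, mul_pow]
  have := Finset.sum_mul_sq_le_sq_mul_sq Finset.univ v w
  simp only [← sq]
  calc _ ≤ (meshLen L M ^ 2) ^ 2 * _ := mul_le_mul_of_nonneg_left this (sq_nonneg _)
    _ = _ := by ring

/-- The interpolation inequality `‖∇_h w‖² ≤ ‖Δ_h w‖ ‖w‖`. -/
theorem gradNorm_sq_le (hL : 0 < L) (hM : Even M) (w : GridFn M) :
    gradNorm L w ^ 2 ≤ gNorm L (lap L w) * gNorm L w := by
  have h : gradNorm L w ^ 2 = -gInner L (lap L w) w := by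
    rw [gradNorm_eq, Real.sq_sqrt (mul_nonneg (sq_nonneg _) (gradSum_nonneg w)), gradSum,
      sum_mul_lap hL hM, gInner, mul_neg]
  rw [h]
  exact (neg_le_abs _).trans (abs_gInner_le _ _)

end

/-- The scaled Young inequality `x⁴ ≤ (256/27) A³ t → x ≤ A + t`. -/
theorem le_add_of_pow_four_le {x A t : ℝ} (hA : 0 ≤ A) (ht : 0 ≤ t)
    (h : x ^ 4 ≤ 256 / 27 * A ^ 3 * t) : x ≤ A + t := by
  by_contra! hx
  have h1 := pow_lt_pow_left₀ hx (add_nonneg hA ht) (by norm_num : 4 ≠ 0)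
  -- This product is exactly (A + t)⁴ - (256/27)A³t; the double root A = 3t is the equality case of
  -- AM–GM.
  have h2 : 0 ≤ (A - 3 * t) ^ 2 * (A ^ 2 + 14 / 27 * A * t + t ^ 2 / 9) := by positivity
  nlinarith

/-! ### DOC sums of grid functions, and the final estimate. -/

namespace TimeMesh

variable {N : ℕ} {T : TimeMesh N}

theorem docSum_eq_sum_Θ₂ (n : ℕ) (a : ℕ → ℕ → ℝ) :
    T.docSum n a = ∑ i, ∑ j, T.Θ₂ n i j * a (j.1 + 2) (i.1 + 2) := by
  rw [docSum, ← sum_fin_eq_sum_Icc n]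
  refine Finset.sum_congr rfl fun i _ => ?_
  have hi := i.2
  let F : ℕ → ℝ := fun k => if k ∈ Finset.Icc 2 (i.1 + 2) then
    T.θ (i.1 + 2) (i.1 + 2 - k) * a k (i.1 + 2) else 0
  have h : ∀ j : Fin (n - 1), T.Θ₂ n i j * a (j.1 + 2) (i.1 + 2) = F (j.1 + 2) := by
    intro j
    simp only [F, Θ₂, Matrix.of_apply, Fin.le_def, Finset.mem_Icc, Nat.add_sub_add_right]
    split_ifs <;> first | rfl | (exfalso; omega) | simp
  refine Eq.trans ?_ ((Finset.sum_congr rfl fun j _ => h j).trans (sum_fin_eq_sum_Icc n F)).symm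
  simp only [F]
  rw [Finset.sum_ite_mem]
  congr 1
  ext; simp only [Finset.mem_Icc, Finset.mem_inter]; omega

variable {M : ℕ} [NeZero M] {L : ℝ}

/-- The time history of a sequence of grid functions at a node. -/
def history (n : ℕ) (F : ℕ → GridFn M) (p : ZMod M × ZMod M) (i : Fin (n - 1)) : ℝ :=
  F (i.1 + 2) p

theorem docSum_gInner (n : ℕ) (F G : ℕ → GridFn M) :
    T.docSum n (fun j k => gInner L (F j) (G k)) =
      meshLen L M ^ 2 * ∑ p, history n G p ⬝ᵥ (T.Θ₂ n *ᵥ history n F p) := by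
  simp only [docSum_eq_sum_Θ₂, gInner, dotProduct, Matrix.mulVec, history, Finset.mul_sum]
  rw [Finset.sum_comm' (t' := Finset.univ) (s' := fun _ => Finset.univ) (by simp)]
  conv_rhs => rw [Finset.sum_comm]
  rw [Finset.sum_comm]
  refine Finset.sum_congr rfl fun i _ => ?_
  conv_rhs => rw [Finset.sum_comm]
  refine Finset.sum_congr rfl fun j _ => Finset.sum_congr rfl fun p _ => ?_
  ring

theorem sum_Λ_history {n : ℕ} (hn : n ≤ N) (F : ℕ → GridFn M) :
    meshLen L M ^ 2 * ∑ p, (T.Λ n *ᵥ history n F p) ⬝ᵥ (T.Λ n *ᵥ history n F p) =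
      ∑ k ∈ Finset.Icc 2 n, T.τ k * gInner L (F k) (F k) := by
  rw [← sum_fin_eq_sum_Icc n]
  simp only [gInner, dotProduct, history, Finset.mul_sum, Λ, Matrix.mulVec_diagonal]
  rw [Finset.sum_comm]
  refine Finset.sum_congr rfl fun i _ => Finset.sum_congr rfl fun p _ => ?_
  have hi := i.2
  have := Real.mul_self_sqrt (T.τ_pos (k := i.1 + 2) (by omega) (by omega)).le
  linear_combination (meshLen L M ^ 2 * F (i.1 + 2) p * F (i.1 + 2) p) * this

/-- The DOC form is bounded by the dissipation and the `τ`-weighted `l²` norm of the source. -/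
theorem exists_dissipation {n : ℕ} (hn : n ≤ N) {m₁ m₂ m₃ : ℝ}
    (h : T.IsEigenBound n m₁ m₂ m₃) (G : ℕ → GridFn M) :
    ∃ Y : ℝ, 0 ≤ Y ∧ m₁ / 2 * Y ≤ T.docSum n (fun j k => gInner L (G j) (G k)) ∧
      ∑ k ∈ Finset.Icc 2 n, T.τ k * gInner L (G k) (G k) ≤ m₂ * Y ∧
      ∀ F : ℕ → GridFn M, T.docSum n (fun j k => gInner L (F j) (G k)) ^ 2 ≤
        Y * ∑ k ∈ Finset.Icc 2 n, T.τ k * gInner L (F k) (F k) := by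
  -- The DOC kernels act only in time, so the dual vector is formed separately at each node;
  -- Cauchy–Schwarz is later applied jointly over nodes and levels.
  choose y h1 h2 h3 using fun p => h.exists_dual_vector_bounds hn (history n G p)
  have hh : 0 ≤ meshLen L M ^ 2 := sq_nonneg _
  refine ⟨meshLen L M ^ 2 * ∑ p, y p ⬝ᵥ y p,
    mul_nonneg hh (Finset.sum_nonneg fun p _ => dotProduct_self_nonneg_real _), ?_, ?_, fun F => ?_⟩
  · rw [docSum_gInner, mul_left_comm, Finset.mul_sum]
    exact mul_le_mul_of_nonneg_left (Finset.sum_le_sum fun p _ => h1 p) hh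
  · rw [← sum_Λ_history hn, mul_left_comm, Finset.mul_sum Finset.univ _ m₂]
    exact mul_le_mul_of_nonneg_left (Finset.sum_le_sum fun p _ => h2 p) hh
  · rw [docSum_gInner, ← sum_Λ_history hn, mul_pow]
    simp_rw [h3]
    have h4 := Finset.sum_mul_sq_le_sq_mul_sq Finset.univ
      (fun q : (ZMod M × ZMod M) × Fin (n - 1) => y q.1 q.2)
      (fun q => (T.Λ n *ᵥ history n F q.1) q.2)
    simp only [Fintype.sum_prod_type (γ := ℝ) (α₁ := ZMod M × ZMod M), sq (y _ _),
      sq ((T.Λ n *ᵥ _) _)] at h4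
    calc _ ≤ (meshLen L M ^ 2) ^ 2 * _ := mul_le_mul_of_nonneg_left h4 (sq_nonneg _)
      _ = _ := by
        simp only [dotProduct]
        ring

theorem docSum_nonlinear_le (hL : 0 < L) (hM : Even M) {n : ℕ} (hn2 : 2 ≤ n) (hn : n ≤ N)
    {m₁ m₂ m₃ : ℝ} (h : T.IsEigenBound n m₁ m₂ m₃) {c_z : ℝ} (hz : IsEmbeddingConst L M c_z)
    (u w : ℕ → GridFn M) {c_u : ℝ} (hu : ∀ k, 2 ≤ k → k ≤ n → lqNorm L 3 (u k) ≤ c_u)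
    (hw : ∀ k, 2 ≤ k → k ≤ n → MeanZero L (w k)) {ε : ℝ} (hε : 0 < ε) :
    T.docSum n (fun j k => gInner L (u j * w j) (lap L (w k))) ≤
      ε * T.docSum n (fun j k => gInner L (lap L (w j)) (lap L (w k))) +
      c_z ^ 4 * c_u ^ 4 * m₂ ^ 3 * m₃ ^ 2 / (m₁ ^ 5 * ε ^ 3) *
        ∑ k ∈ Finset.Icc 2 n, T.τ k * gNorm L (w k) ^ 2 := by
  have hτ : ∀ k ∈ Finset.Icc 2 n, 0 ≤ T.τ k := fun k hk => by
    rw [Finset.mem_Icc] at hk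
    exact (T.τ_pos (by omega) (by omega)).le
  obtain ⟨Y, hY, hQ, hZ, hF⟩ := T.exists_dissipation (L := L) hn h fun k => lap L (w k)
  have hS := hF fun k => u k * w k
  set S := T.docSum n (fun j k => gInner L (u j * w j) (lap L (w k)))
  set Q := T.docSum n (fun j k => gInner L (lap L (w j)) (lap L (w k)))
  set W := ∑ k ∈ Finset.Icc 2 n, T.τ k * gNorm L (w k) ^ 2
  set G := ∑ k ∈ Finset.Icc 2 n, T.τ k * (gNorm L (lap L (w k)) * gNorm L (w k)) with hG
  have hW0 : 0 ≤ W := Finset.sum_nonneg fun k hk => mul_nonneg (hτ k hk) (sq_nonneg _)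
  have hF2 : ∑ k ∈ Finset.Icc 2 n, T.τ k * gInner L (u k * w k) (u k * w k) ≤
      (c_u * c_z) ^ 2 * G := by
    rw [hG, Finset.mul_sum]
    refine Finset.sum_le_sum fun k hk => ?_
    rw [mul_left_comm]
    refine mul_le_mul_of_nonneg_left ?_ (hτ k hk)
    rw [Finset.mem_Icc] at hk
    calc _ ≤ lqNorm L 3 (u k) ^ 2 * lqNorm L 6 (w k) ^ 2 := gInner_mul_self_le _ _
      _ ≤ c_u ^ 2 * (c_z * gradNorm L (w k)) ^ 2 :=
          mul_le_mul (pow_le_pow_left₀ (lqNorm_nonneg _ _) (hu k hk.1 hk.2) 2)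
            (pow_le_pow_left₀ (lqNorm_nonneg _ _) (hz.2 _ (hw k hk.1 hk.2)) 2)
            (sq_nonneg _) (sq_nonneg _)
      _ = (c_u * c_z) ^ 2 * gradNorm L (w k) ^ 2 := by ring
      _ ≤ _ := mul_le_mul_of_nonneg_left (gradNorm_sq_le hL hM _) (sq_nonneg _)
  -- Cauchy–Schwarz in time; the Laplacian factor is returned to Y through the second dual bound.
  have hG2 : G ^ 2 ≤ (m₂ * Y) * W := by
    refine (Finset.sum_sq_le_sum_mul_sum_of_sq_le_mul (Finset.Icc 2 n)
      (f := fun k => T.τ k * gInner L (lap L (w k)) (lap L (w k)))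
      (g := fun k => T.τ k * gNorm L (w k) ^ 2)
      (fun k hk => mul_nonneg (hτ k hk) (gInner_self_nonneg _))
      (fun k hk => mul_nonneg (hτ k hk) (sq_nonneg _)) fun k _ => ?_).trans
      (mul_le_mul_of_nonneg_right hZ hW0)
    rw [← gNorm_sq]
    exact le_of_eq (by ring)
  have hm₁ := h.pos₁
  have hm₂ := h.pos₂
  have hm₃ := h.pos₃
  have hQ0 : 0 ≤ Q := le_trans (by positivity) hQ
  have hYQ : Y ≤ 2 * Q / m₁ := by
    rw [le_div_iff₀ hm₁]; linarith
  -- Chosen to give equality in the hypothesis of the Young inequality with A = εQ: 27/32 = 8 ·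
  -- 27/256, the 8 coming from (2Q/m₁)³.
  set t := 27 / 32 * ((c_u * c_z) ^ 4 * m₂ / (m₁ ^ 3 * ε ^ 3)) * W
  have ht : t ≤ c_z ^ 4 * c_u ^ 4 * m₂ ^ 3 * m₃ ^ 2 / (m₁ ^ 5 * ε ^ 3) * W := by
    refine mul_le_mul_of_nonneg_right ?_ hW0
    -- The argument itself yields m₂/m₁³; this inequality weakens it to m₂³m₃²/m₁⁵.
    have h1 : m₁ ^ 2 ≤ (m₂ * m₃) ^ 2 := pow_le_pow_left₀ hm₁.le (h.le_mul hn2 hn) 2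
    have h2 : 0 ≤ (c_u * c_z) ^ 4 * m₂ := by positivity
    have h3 : (c_u * c_z) ^ 4 * m₂ / (m₁ ^ 3 * ε ^ 3) =
        ((c_u * c_z) ^ 4 * m₂) * m₁ ^ 2 / (m₁ ^ 5 * ε ^ 3) := by field_simp
    rw [h3, ← mul_div_assoc]
    refine div_le_div_of_nonneg_right ?_ (by positivity)
    have h4 := mul_le_mul_of_nonneg_left h1 h2
    have h5 : 0 ≤ ((c_u * c_z) ^ 4 * m₂) * m₁ ^ 2 := by positivity
    calc _ ≤ ((c_u * c_z) ^ 4 * m₂) * (m₂ * m₃) ^ 2 := by linarith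
      _ = _ := by ring
  have ht0 : 0 ≤ t := by positivity
  refine (le_add_of_pow_four_le (mul_nonneg hε.le hQ0) ht0 ?_).trans (by linarith)
  have hS2 : S ^ 2 ≤ Y * ((c_u * c_z) ^ 2 * G) :=
    hS.trans (mul_le_mul_of_nonneg_left hF2 hY)
  calc S ^ 4 = (S ^ 2) ^ 2 := by ring
    _ ≤ (Y * ((c_u * c_z) ^ 2 * G)) ^ 2 := pow_le_pow_left₀ (sq_nonneg _) hS2 2
    _ = Y ^ 2 * (c_u * c_z) ^ 4 * G ^ 2 := by ring
    _ ≤ Y ^ 2 * (c_u * c_z) ^ 4 * ((m₂ * Y) * W) :=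
        mul_le_mul_of_nonneg_left hG2 (by positivity)
    _ = (c_u * c_z) ^ 4 * m₂ * W * Y ^ 3 := by ring
    _ ≤ (c_u * c_z) ^ 4 * m₂ * W * (2 * Q / m₁) ^ 3 :=
        mul_le_mul_of_nonneg_left (pow_le_pow_left₀ hY hYQ 3) (by positivity)
    _ = _ := by
        simp only [t]
        field_simp
        ring

end TimeMesh

end BDF2

end

theorem lemma3p9 (rUser : ℝ) :
    -- the constants `m₁, m₂, m₃` exist, and depend on `rUser` only
    (∃ m₁ m₂ m₃ : ℝ, ∀ (N : ℕ) (T : TimeMesh N), T.S0 rUser →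
      ∀ n : ℕ, 2 ≤ n → n ≤ N → T.IsEigenBound n m₁ m₂ m₃) ∧
    ∀ L : ℝ, 0 < L →
      -- the constant `c_z` exists, and depends on `L` only
      (∃ c_z : ℝ, ∀ (M : ℕ) [NeZero M], Even M → IsEmbeddingConst L M c_z) ∧
      -- the inequality, for all such constants
      ∀ (N : ℕ) (T : TimeMesh N), T.S0 rUser →
      ∀ n : ℕ, 2 ≤ n → n ≤ N →
      ∀ m₁ m₂ m₃ : ℝ, T.IsEigenBound n m₁ m₂ m₃ →
      ∀ (M : ℕ) [NeZero M], Even M →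
      ∀ c_z : ℝ, IsEmbeddingConst L M c_z →
      ∀ (u w : ℕ → GridFn M) (c_u : ℝ),
        (∀ k, 2 ≤ k → k ≤ n → lqNorm L 3 (u k) ≤ c_u) →
        (∀ k, 2 ≤ k → k ≤ n → MeanZero L (w k)) →
      ∀ ε : ℝ, 0 < ε →
        T.docSum n (fun j k => gInner L (u j * w j) (lap L (w k))) ≤
          ε * T.docSum n (fun j k => gInner L (lap L (w j)) (lap L (w k))) +
          c_z ^ 4 * c_u ^ 4 * m₂ ^ 3 * m₃ ^ 2 / (m₁ ^ 5 * ε ^ 3) *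
            ∑ k ∈ Finset.Icc 2 n, T.τ k * gNorm L (w k) ^ 2 := by
  -- The constants are absolute: `rUser` matters only through the cap 4.864.
  refine ⟨⟨0.00004, 16, 100000, fun N T hS n _ hn => hS.isEigenBound hn⟩, fun L hL =>
    ⟨⟨_, fun M _ hM => isEmbeddingConst hL hM⟩, ?_⟩⟩
  intro N T _ n h2 hn m₁ m₂ m₃ h M _ hM c_z hz u w c_u hu hw ε hε
  exact T.docSum_nonlinear_le hL hM h2 hn h hz u w hu hw hε
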